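/- **Setting.** Let $n\in\{2,3\}$ and let a bounded domain $Y\subset\mathbb R^n$ be decomposed, up to a set of $\mathcal H^{n-1}$-measure zero (e.g. tips of immersed fractures), into finitely many pairwise disjoint flat subdomains $\Omega_i^d$, $i\in I^d$, $0\le d\le n$, where $\Omega_i^d$ is a relatively open subset of a $d$-dimensional affine subspace. For $0\le d<n$ let $\Gamma_{ij}^d$, $j\in J_i^d$, be the interfaces between $\Omega_i^d$ and the adjacent subdomains of dimension $d+1$ (one interface for each side from which $\Omega_i^d$ is touched; geometrically $\Gamma^d_{ij}$ coincides with $\Omega^d_i$), with normal $\nu$ pointing out of the $(d+1)$-dimensional subdomain. Let $\partial Y$ be split into disjoint parts, a pressure part of positive measure and a no-flux part; immersed tips may be added to the no-flux part. On each subdomain of dimension $\ge1$ let $K$ be a constant symmetric positive definite tensor, and on each interface let $K_\nu,\gamma>0$ be constants. Each subdomain carries a simplicial mesh that resolves interfaces and boundary parts, and each interface an independent simplicial mortar mesh. Let $V_{0h}$ be the lowest-order Raviart–Thomas fields on the subdomains of dimension $\ge 1$ (normal components continuous across facets inside a subdomain) with zero normal component on the no-flux boundary and on all interfaces; let $\Lambda_h$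 be the piecewise constants on the mortar meshes, $Q_h$ the piecewise constants on the subdomain meshes, and $W_h=V_{0h}\times\Lambda_h$. For $\mu\in\Lambda_h$ let $R_h\mu$ be the piecewise Raviart–Thomas field whose normal component is, on facets on interfaces, the $L^2$-projection of $\mu$ onto the functions constant on each such facet, and $0$ on all other facets; let $[\![\mu]\!]=-\sum_{j\in J_i^d}\mu_{ij}$ on $\Omega_i^d$. For $w=[u_0,\lambda]$, $r=[v_0,\mu]\in W_h$ and $q\in Q_h$ put $$a(w,r)=(K^{-1}(u_0+R_h\lambda),v_0+R_h\mu)_\Omega+(\gamma K_\nu^{-1}\lambda,\mu)_\Gamma,\qquad b(r,q)=-(q,\nabla\cdot(v_0+R_h\mu)+[\![\mu]\!])_\Omega ,$$ and let $a^D$ be $a$ with $(K^{-1}u,v)_\Omega$ replaced by $\sum_T\sum_{f\subset\partial T}(u\cdot\nu_f)(v\cdot\nu_f)(K^{-1}\phi_f,\phi_f)_T$, where $T$ runs over all cells of dimension $\ge1$, $f$ over the facets of $T$, and $\phi_f$ is the local Raviart–Thomas basis field with normal component $1$ on $f$ and $0$ on the other facets. Define $A,D_A:W_h\to W_h'$ and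 $B:W_h\to Q_h'$ by $\langle Aw,r\rangle=a(w,r)$, $\langle D_Aw,r\rangle=a^D(w,r)$, $\langle Br,q\rangle=b(r,q)$, and $$\mathcal A=\begin{pmatrix}A&B^T\\-B&0\end{pmatrix},\qquad \mathcal M_D=\begin{pmatrix}H_w&0\\0&H_p\end{pmatrix},\qquad \mathcal M_U=\begin{pmatrix}H_w^{-1}&B^T\\0&H_p^{-1}\end{pmatrix}^{-1},$$ where $H_w:W_h'\to W_h$ and $H_p:Q_h'\to Q_h$ are symmetric positive definite. For $x',y'\in W_h'\times Q_h'$ write $(x',y')_{\mathcal M_D}=\langle x',\mathcal M_Dy'\rangle$ and $\|x'\|_{\mathcal M_D}^2=(x',x')_{\mathcal M_D}$. **Theorem.** Let $c_{1,w},c_{2,w},c_{1,p},c_{2,p}>0$, $0\le\rho<1$, $\sigma$ and $\kappa$ be given. There are constants $\xi_1,\xi_2>0$ depending only on these numbers and on $n$ such that the following holds for all decompositions, parameters $K,K_\nu,\gamma$ and meshes as above for which every subdomain cell $T$ of dimension $\ge1$ contains a ball of some radius $r>0$ (of its own dimension) with $\operatorname{diam}T\le\sigma r$, and on every subdomain the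 ratio of the largest to the smallest eigenvalue of $K$ is at most $\kappa$ ($\kappa=1$ being the case of scalar $K$). If $$c_{1,w}\langle f,H_wf\rangle\le\langle f,A^{-1}f\rangle\le c_{2,w}\langle f,H_wf\rangle\quad\forall f\in W_h',$$ $$c_{1,p}\langle g,H_pg\rangle\le\langle g,(BD_A^{-1}B^T)^{-1}g\rangle\le c_{2,p}\langle g,H_pg\rangle\quad\forall g\in Q_h',$$ and $\|I-H_wA\|_A\le\rho$ (the operator norm induced by $\|w\|_A=\langle Aw,w\rangle^{1/2}$), then the block operator defining $\mathcal M_U$ is invertible, and for every $x'=\mathcal M_U^{-1}x$ with $x\in W_h\times Q_h$, $x\ne0$, $$\xi_1\le\frac{(\mathcal A\mathcal M_Ux',x')_{\mathcal M_D}}{(x',x')_{\mathcal M_D}},\qquad \frac{\|\mathcal A\mathcal M_Ux'\|_{\mathcal M_D}}{\|x'\|_{\mathcal M_D}}\le\xi_2 .$$ In particular $\xi_1,\xi_2$ do not depend on the mesh sizes, on the magnitudes and jumps of $K$, or on $K_\nu$ and $\gamma$. -/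

import Mathlib

open MeasureTheory Module
open scoped Topology

noncomputable section

namespace FracturedFlow

/-! ## Simplices and the lowest-order Raviart--Thomas space -/

/-- Euclidean space of dimension `d`. -/
abbrev Vec (d : ℕ) := EuclideanSpace ℝ (Fin d)

/-- A nondegenerate `d`-simplex in `ℝ^d`, given by its affinely independent vertices. -/
abbrev Cell (d : ℕ) := Affine.Simplex ℝ (Vec d) d

/-- The closed simplex as a set of points. -/
def Cell.set {d : ℕ} (T : Cell d) : Set (Vec d) := convexHull ℝ (Set.range T.points)

/-- The closed facet of a simplex opposite to the vertex `f`. -/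
def Cell.facet {d : ℕ} (T : Cell d) (f : Fin (d + 1)) : Set (Vec d) :=
  convexHull ℝ (T.points '' {f}ᶜ)

/-- The relatively open facet of a simplex opposite to the vertex `f`. -/
def Cell.openFacet {d : ℕ} (T : Cell d) (f : Fin (d + 1)) : Set (Vec d) :=
  intrinsicInterior ℝ (T.facet f)

/-- The outward unit normal on the facet opposite to `f`: the altitude points from the vertex
to its foot on the facet. -/
def Cell.normal {d : ℕ} (T : Cell (d + 1)) (f : Fin (d + 2)) : Vec (d + 1) :=
  (T.height f)⁻¹ • (T.altitudeFoot f - T.points f)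

/-- The local space `ℙ₀^d + x ℙ₀` of lowest-order Raviart--Thomas fields on `ℝ^d`. -/
def RT0 (d : ℕ) : Submodule ℝ (Vec d → Vec d) where
  carrier := {v | ∃ (m : Vec d) (s : ℝ), ∀ x, v x = m + s • x}
  add_mem' := by
    rintro u v ⟨m, s, hu⟩ ⟨m', s', hv⟩
    exact ⟨m + m', s + s', fun x => by simp only [Pi.add_apply, hu, hv, add_smul]; abel⟩
  zero_mem' := ⟨0, 0, fun x => by simp⟩
  smul_mem' := by
    rintro c v ⟨m, s, hv⟩
    exact ⟨c • m, c * s, fun x => by simp only [Pi.smul_apply, hv, smul_add, mul_smul]⟩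

lemma contDiff_of_RT0 {d : ℕ} (v : RT0 d) : ContDiff ℝ 1 (v : Vec d → Vec d) := by
  obtain ⟨v, m, s, hv⟩ := v
  obtain rfl : v = fun x => m + s • x := funext hv
  change ContDiff ℝ 1 fun x => m + s • x
  fun_prop

lemma Cell.isCompact_set {d : ℕ} (T : Cell d) : IsCompact T.set :=
  (Set.finite_range T.points).isCompact_convexHull (𝕜 := ℝ)

/-- The Raviart--Thomas basis field of the facet opposite to `f`: its normal component is `1` on
that facet and `0` on all other facets. -/
def Cell.basisField {d : ℕ} (T : Cell (d + 1)) (f : Fin (d + 2)) : RT0 (d + 1) :=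
  ⟨fun x => (T.height f)⁻¹ • (x - T.points f),
    -((T.height f)⁻¹ • T.points f), (T.height f)⁻¹, fun x => by simp only [smul_sub]; abel⟩

/-- The (constant) outward normal component of a Raviart--Thomas field on the facet opposite
to `f`, evaluated at the centroid of that facet. -/
def Cell.normalComp {d : ℕ} (T : Cell (d + 1)) (f : Fin (d + 2)) : RT0 (d + 1) →ₗ[ℝ] ℝ where
  toFun v := inner ℝ ((v : Vec (d + 1) → Vec (d + 1)) (T.faceOppositeCentroid f)) (T.normal f)
  map_add' u v := by simp [inner_add_left]
  map_smul' c v := by simp [real_inner_smul_left]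

/-- The divergence of a vector field. -/
def divergence {d : ℕ} (v : Vec d → Vec d) (x : Vec d) : ℝ :=
  LinearMap.trace ℝ (Vec d) (fderiv ℝ v x : Vec d →ₗ[ℝ] Vec d)

lemma integrableOn_div_of_RT0 {d : ℕ} (v : RT0 d) (T : Cell d) :
    IntegrableOn (divergence (v : Vec d → Vec d)) T.set := by
  refine ContinuousOn.integrableOn_compact T.isCompact_set (Continuous.continuousOn ?_)
  have h : Continuous (fderiv ℝ (v : Vec d → Vec d)) := (contDiff_of_RT0 v).continuous_fderiv (by simp)
  exact ((LinearMap.trace ℝ (Vec d)).comp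
    (ContinuousLinearMap.coeLM ℝ)).continuous_of_finiteDimensional.comp h

/-- `∫_T ∇·v` as a linear functional. -/
def Cell.intDiv {d : ℕ} (T : Cell d) : RT0 d →ₗ[ℝ] ℝ where
  toFun v := ∫ x in T.set, divergence (v : Vec d → Vec d) x
  map_add' u v := by
    rw [← integral_add (integrableOn_div_of_RT0 u T) (integrableOn_div_of_RT0 v T)]
    congr 1; ext x
    have hu := ((contDiff_of_RT0 u).differentiable (by simp)) x
    have hv := ((contDiff_of_RT0 v).differentiable (by simp)) x
    simp [divergence, fderiv_add hu hv]
  map_smul' c v := by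
    rw [RingHom.id_apply, smul_eq_mul, ← integral_const_mul]
    congr 1; ext x
    have hv := ((contDiff_of_RT0 v).differentiable (by simp)) x
    simp [divergence, fderiv_const_smul hv c]

/-- The integrand `K⁻¹ u · v`. -/
def weighted {d : ℕ} (K : Matrix (Fin d) (Fin d) ℝ) (u v : Vec d → Vec d) (x : Vec d) : ℝ :=
  inner ℝ (Matrix.toEuclideanLin K⁻¹ (u x)) (v x)

lemma integrableOn_weighted_of_RT0 {d : ℕ} (K : Matrix (Fin d) (Fin d) ℝ) (u v : RT0 d) (T : Cell d) :
    IntegrableOn (weighted K (u : Vec d → Vec d) (v : Vec d → Vec d)) T.set := by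
  refine ContinuousOn.integrableOn_compact T.isCompact_set (Continuous.continuousOn ?_)
  exact (((Matrix.toEuclideanLin K⁻¹).continuous_of_finiteDimensional.comp
    (contDiff_of_RT0 u).continuous).inner (contDiff_of_RT0 v).continuous)

/-- The element form `(K⁻¹ u, v)_T = ∫_T K⁻¹ u · v`. -/
def Cell.fluxForm {d : ℕ} (K : Matrix (Fin d) (Fin d) ℝ) (T : Cell d) :
    RT0 d →ₗ[ℝ] RT0 d →ₗ[ℝ] ℝ :=
  LinearMap.mk₂ ℝ
    (fun u v => ∫ x in T.set, weighted K (u : Vec d → Vec d) (v : Vec d → Vec d) x)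
    (fun u u' v => by
      rw [← integral_add (integrableOn_weighted_of_RT0 K u v T) (integrableOn_weighted_of_RT0 K u' v T)]
      congr 1; ext x; simp [weighted, inner_add_left])
    (fun c u v => by
      rw [smul_eq_mul, ← integral_const_mul]
      congr 1; ext x; simp [weighted, real_inner_smul_left])
    (fun u v v' => by
      rw [← integral_add (integrableOn_weighted_of_RT0 K u v T) (integrableOn_weighted_of_RT0 K u v' T)]
      congr 1; ext x; simp [weighted, inner_add_right])
    (fun c u v => by
      rw [smul_eq_mul, ← integral_const_mul]
      congr 1; ext x; simp [weighted, real_inner_smul_right])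

/-- The diagonal element form
`(K⁻¹ u, v)_{D,T} = ∑_f (u·ν_f) (v·ν_f) (K⁻¹ φ_f, φ_f)_T`. -/
def Cell.diagFluxForm {d : ℕ} (K : Matrix (Fin (d + 1)) (Fin (d + 1)) ℝ) (T : Cell (d + 1)) :
    RT0 (d + 1) →ₗ[ℝ] RT0 (d + 1) →ₗ[ℝ] ℝ :=
  LinearMap.mk₂ ℝ
    (fun u v => ∑ f : Fin (d + 2), T.normalComp f u * T.normalComp f v *
      T.fluxForm K (T.basisField f) (T.basisField f))
    (fun u u' v => by simp [add_mul, Finset.sum_add_distrib])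
    (fun c u v => by simp [Finset.mul_sum, mul_assoc])
    (fun u v v' => by simp [mul_add, add_mul, Finset.sum_add_distrib])
    (fun c u v => by
      simp only [map_smul, smul_eq_mul, Finset.mul_sum]
      exact Finset.sum_congr rfl fun f _ => by ring)

/-! ## Mixed-dimensional geometry -/

/-- `ν` is the unit normal of an interface between the `d`-dimensional piece `ω`, placed in `ℝ^n`
by `e`, and the `(d+1)`-dimensional piece `ω'`, placed by `e'`: it is tangent to `ω'`, normal to
`ω`, and `ω'` lies on the side `-ν` of `ω` (so `ν` points out of `ω'`). -/
def IsSide {n d : ℕ} (ω : Set (Vec d)) (e : Vec d →ᵃⁱ[ℝ] Vec n)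
    (ω' : Set (Vec (d + 1))) (e' : Vec (d + 1) →ᵃⁱ[ℝ] Vec n) (ν : Vec (d + 1)) : Prop :=
  ‖ν‖ = 1 ∧
  (∀ y : Vec d, inner ℝ (e'.linearIsometry ν) (e.linearIsometry y) = 0) ∧
  ∀ x ∈ ω, ∀ᶠ t : ℝ in 𝓝[>] 0, e x - t • e'.linearIsometry ν ∈ e' '' ω'

/-- A mixed-dimensional decomposition of a fractured domain of dimension `n`.
The subdomain `Ω_i^d` (`i ∈ I d`) is flat: it is the image `emb d i '' Ω d i` of an open set of
`ℝ^d` under an affine isometry, so that `I d` is empty for `d > n`. -/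
structure Geometry (n : ℕ) where
  /-- the bulk domain, fractures included -/
  Y : Set (Vec n)
  isOpen_Y : IsOpen Y
  isConnected_Y : IsConnected Y
  isBounded_Y : Bornology.IsBounded Y
  /-- index set of the `d`-dimensional subdomains -/
  I : ℕ → Type
  fintypeI : ∀ d, Fintype (I d)
  Ω : ∀ d, I d → Set (Vec d)
  emb : ∀ d, I d → (Vec d →ᵃⁱ[ℝ] Vec n)
  isOpen_Ω : ∀ d i, IsOpen (Ω d i)
  nonempty_Ω : ∀ d i, (Ω d i).Nonempty
  Ω_subset : ∀ d i, emb d i '' Ω d i ⊆ Y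
  Ω_disjoint : ∀ a b : (Σ d, I d), a ≠ b →
    Disjoint (emb a.1 a.2 '' Ω a.1 a.2) (emb b.1 b.2 '' Ω b.1 b.2)
  /-- the subdomains exhaust the domain up to sets of dimension at most `n - 2`
  (for example the tips of fractures that end inside the domain) -/
  Ω_exhaust : μHE[n - 1] (Y \ ⋃ a : (Σ d, I d), emb a.1 a.2 '' Ω a.1 a.2) = 0
  /-- index set of the interfaces `Γ_ij^d` between `Ω_i^d` and the adjacent subdomains of dimension
  `d + 1`; each of them occupies the same place as `Ω_i^d`, and a subdomain that touches `Ω_i^d`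
  from two sides gives two interfaces -/
  J : ∀ d, I d → Type
  fintypeJ : ∀ d i, Fintype (J d i)
  /-- the adjacent `(d+1)`-dimensional subdomain -/
  nbr : ∀ d i, J d i → I (d + 1)
  /-- the unit normal on the interface that points out of the adjacent subdomain -/
  nrm : ∀ d i, J d i → Vec (d + 1)
  side_iff : ∀ d i k ν, IsSide (Ω d i) (emb d i) (Ω (d + 1) k) (emb (d + 1) k) ν ↔
    ∃ j, nbr d i j = k ∧ nrm d i j = ν
  side_inj : ∀ d i j j', nbr d i j = nbr d i j' → nrm d i j = nrm d i j' → j = j'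
  /-- the part of the boundary with prescribed pressure -/
  bdryD : Set (Vec n)
  /-- the part of the boundary with zero flux; it may also contain immersed fracture tips -/
  bdryN : Set (Vec n)
  bdryD_subset : bdryD ⊆ frontier Y
  frontier_subset : frontier Y ⊆ bdryD ∪ bdryN
  bdry_disjoint : Disjoint bdryD bdryN
  bdryN_disjoint : ∀ d i, Disjoint bdryN (emb d i '' Ω d i)
  bdryD_pos : 0 < μHE[n - 1] bdryD

attribute [instance] Geometry.fintypeI Geometry.fintypeJ

/-- Physical parameters, constant on each subdomain and each interface: the symmetric positive
definite permeability tensors `K` on the subdomains of dimension `d + 1 ≥ 1`, the normal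
permeabilities `Kν` and the lengths `γ` (apertures) on the interfaces. -/
structure Params {n : ℕ} (G : Geometry n) where
  K : ∀ d, G.I (d + 1) → Matrix (Fin (d + 1)) (Fin (d + 1)) ℝ
  K_posDef : ∀ d k, (K d k).PosDef
  Kν : ∀ d i, G.J d i → ℝ
  Kν_pos : ∀ d i j, 0 < Kν d i j
  γ : ∀ d i, G.J d i → ℝ
  γ_pos : ∀ d i j, 0 < γ d i j

/-- On each subdomain the quotient of the largest and the smallest eigenvalue of `K` is at
most `κ`. No relation between different subdomains is required; for `κ = 1` the tensors are
arbitrary positive scalars. -/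
def Params.AnisotropyLE {n : ℕ} {G : Geometry n} (P : Params G) (κ : ℝ) : Prop :=
  ∀ d k, ∃ m : ℝ, 0 < m ∧ ∀ ξ : Vec (d + 1),
    m * ‖ξ‖ ^ 2 ≤ inner ℝ (Matrix.toEuclideanLin (P.K d k) ξ) ξ ∧
    inner ℝ (Matrix.toEuclideanLin (P.K d k) ξ) ξ ≤ κ * m * ‖ξ‖ ^ 2

/-! ## Meshes -/

/-- A conforming simplicial triangulation of an open set `ω ⊆ ℝ^d`. Cells that meet only in
the boundary of `ω` (across a slit) need not match. -/
structure Triangulation {d : ℕ} (ω : Set (Vec d)) where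
  cells : Finset (Cell d)
  interior_subset : ∀ T ∈ cells, interior T.set ⊆ ω
  cover : ⋃ T ∈ cells, T.set = closure ω
  disjoint_interior : ∀ S ∈ cells, ∀ T ∈ cells, S ≠ T → Disjoint (interior S.set) (interior T.set)
  conforming : ∀ S ∈ cells, ∀ T ∈ cells, (S.set ∩ T.set ∩ ω).Nonempty →
    S.set ∩ T.set = convexHull ℝ (Set.range S.points ∩ Set.range T.points)

/-- The facet of a cell `T` of the `k`-th subdomain of dimension `d + 1` that is opposite to the
vertex `f` lies on the interface `Γ_ij^d`. -/
def Geometry.OnSide {n : ℕ} (G : Geometry n) (d : ℕ) (k : G.I (d + 1)) (T : Cell (d + 1))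
    (f : Fin (d + 2)) (i : G.I d) (j : G.J d i) : Prop :=
  G.nbr d i j = k ∧ T.normal f = G.nrm d i j ∧
    G.emb (d + 1) k '' T.openFacet f ⊆ G.emb d i '' G.Ω d i

/-- Simplicial meshes of all subdomains, resolving interfaces and boundary parts, and independent
mortar meshes of all interfaces. -/
structure Discretization {n : ℕ} (G : Geometry n) where
  mesh : ∀ d (i : G.I d), Triangulation (G.Ω d i)
  mortar : ∀ d (i : G.I d), G.J d i → Triangulation (G.Ω d i)
  facet_fit : ∀ d (k : G.I (d + 1)), ∀ T ∈ (mesh (d + 1) k).cells, ∀ f : Fin (d + 2),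
    T.openFacet f ⊆ G.Ω (d + 1) k ∨
    (∃ i j, G.OnSide d k T f i j) ∨
    G.emb (d + 1) k '' T.openFacet f ⊆ G.bdryD ∨
    G.emb (d + 1) k '' T.openFacet f ⊆ G.bdryN

/-- Shape regularity of the subdomain meshes: each cell contains a ball whose radius is at least
`1/σ` times the diameter of the cell. -/
def Discretization.ShapeRegular {n : ℕ} {G : Geometry n} (𝒯 : Discretization G) (σ : ℝ) : Prop :=
  ∀ d (k : G.I (d + 1)), ∀ T ∈ (𝒯.mesh (d + 1) k).cells, ∃ (c : Vec (d + 1)) (r : ℝ),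
    0 < r ∧ Metric.closedBall c r ⊆ T.set ∧ Metric.diam T.set ≤ σ * r

/-! ## Discrete spaces -/

section Spaces

variable {n : ℕ} {G : Geometry n} (𝒯 : Discretization G)

/-- Piecewise (broken) Raviart--Thomas fields on the subdomains of dimension `d + 1 ≥ 1`. -/
abbrev Broken :=
  (d : ℕ) → (k : G.I (d + 1)) → ↥(𝒯.mesh (d + 1) k).cells → ↥(RT0 (d + 1))

/-- `V_h`: Raviart--Thomas fields with continuous normal component across the facets inside each
subdomain (so with divergence in `L²` of each subdomain) and zero normal component on the no-flux
boundary. -/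
def Vh : Submodule ℝ (Broken 𝒯) where
  carrier := {v |
    (∀ d k (S T : ↥(𝒯.mesh (d + 1) k).cells) (f g : Fin (d + 2)), S ≠ T →
      S.1.facet f = T.1.facet g → S.1.openFacet f ⊆ G.Ω (d + 1) k →
      S.1.normalComp f (v d k S) + T.1.normalComp g (v d k T) = 0) ∧
    (∀ d k (T : ↥(𝒯.mesh (d + 1) k).cells) (f : Fin (d + 2)),
      G.emb (d + 1) k '' T.1.openFacet f ⊆ G.bdryN → T.1.normalComp f (v d k T) = 0)}
  add_mem' := by
    rintro u v ⟨hu, hu'⟩ ⟨hv, hv'⟩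
    refine ⟨fun d k S T f g h1 h2 h3 => ?_, fun d k T f h => ?_⟩
    · have e1 := hu d k S T f g h1 h2 h3
      have e2 := hv d k S T f g h1 h2 h3
      simp only [Pi.add_apply, map_add]
      linarith
    · simp [hu' d k T f h, hv' d k T f h]
  zero_mem' := by simp
  smul_mem' := by
    rintro c v ⟨hv, hv'⟩
    refine ⟨fun d k S T f g h1 h2 h3 => ?_, fun d k T f h => ?_⟩
    · have e2 := hv d k S T f g h1 h2 h3
      simp only [Pi.smul_apply, map_smul, smul_eq_mul, ← mul_add, e2, mul_zero]
    · simp [hv' d k T f h]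

/-- Fields with zero normal component on all interfaces. -/
def noInterfaceFlux : Submodule ℝ (Broken 𝒯) where
  carrier := {v | ∀ d k (T : ↥(𝒯.mesh (d + 1) k).cells) (f : Fin (d + 2)) i j,
      G.OnSide d k T.1 f i j → T.1.normalComp f (v d k T) = 0}
  add_mem' := by
    intro u v hu hv d k T f i j h
    simp [hu d k T f i j h, hv d k T f i j h]
  zero_mem' := by intro d k T f i j _; simp
  smul_mem' := by
    intro c v hv d k T f i j h
    simp [hv d k T f i j h]

/-- `V_{0h}`: the fields of `V_h` with zero normal component on all interfaces. -/
def V0h : Submodule ℝ (Broken 𝒯) := Vh 𝒯 ⊓ noInterfaceFlux 𝒯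

/-- `Λ_h`: piecewise constants on the mortar meshes. -/
abbrev Lambdah :=
  (d : ℕ) → (i : G.I d) → (j : G.J d i) → ↥(𝒯.mortar d i j).cells → ℝ

/-- `Q_h`: piecewise constants on the subdomain meshes. -/
abbrev Qh := (d : ℕ) → (i : G.I d) → ↥(𝒯.mesh d i).cells → ℝ

/-- `W_h = V_{0h} × Λ_h`. -/
abbrev Wh := ↥(V0h 𝒯) × Lambdah 𝒯

/-- The facet of a cell of the `k`-th `(d+1)`-dimensional subdomain, in the coordinates of
`Ω_i^d`. -/
def facetTrace (G : Geometry n) (d : ℕ) (k : G.I (d + 1)) (T : Cell (d + 1)) (f : Fin (d + 2))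
    (i : G.I d) : Set (Vec d) :=
  G.emb d i ⁻¹' (G.emb (d + 1) k '' T.facet f)

open Classical in
/-- The value on a facet of the piecewise constant `Π̂_h μ` (and `0` if the facet is on no
interface). The normal traces of `V_h` on an interface are all the functions that are constant on
each facet there, so the `L²` projection `Π̂_h μ` onto them is the mean value of `μ` over each
facet `F`, which is `∑_M μ_M |F ∩ M| / |F|` with `M` running over the mortar cells. -/
def projTrace (d : ℕ) (k : G.I (d + 1)) (T : Cell (d + 1)) (f : Fin (d + 2)) :
    Lambdah 𝒯 →ₗ[ℝ] ℝ where
  toFun μ := ∑ i : G.I d, ∑ j : G.J d i, if G.OnSide d k T f i j then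
    ∑ M : ↥(𝒯.mortar d i j).cells, μ d i j M *
      (volume.real (facetTrace G d k T f i ∩ M.1.set) / volume.real (facetTrace G d k T f i))
    else 0
  map_add' μ μ' := by
    simp only [← Finset.sum_add_distrib]
    refine Finset.sum_congr rfl fun i _ => Finset.sum_congr rfl fun j _ => ?_
    split_ifs <;> simp [add_mul, Finset.sum_add_distrib]
  map_smul' c μ := by
    simp only [RingHom.id_apply, smul_eq_mul, Finset.mul_sum]
    refine Finset.sum_congr rfl fun i _ => Finset.sum_congr rfl fun j _ => ?_
    split_ifs <;> simp [Finset.mul_sum, mul_assoc]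

/-- The discrete extension `R_h`: the Raviart--Thomas field with normal component `Π̂_h μ` on the
facets on interfaces and `0` on all other facets. -/
def Rh : Lambdah 𝒯 →ₗ[ℝ] Broken 𝒯 where
  toFun μ := fun d k T => ∑ f : Fin (d + 2), projTrace 𝒯 d k T.1 f μ • T.1.basisField f
  map_add' μ μ' := by
    funext d k T
    simp [add_smul, Finset.sum_add_distrib]
  map_smul' c μ := by
    funext d k T
    simp [mul_smul, Finset.smul_sum]

/-- The total flux `v_0 + R_h μ` of `[v_0, μ] ∈ W_h`. -/
def totalFlux : Wh 𝒯 →ₗ[ℝ] Broken 𝒯 where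
  toFun r := (r.1 : Broken 𝒯) + Rh 𝒯 r.2
  map_add' r r' := by simp only [Prod.fst_add, Prod.snd_add, Submodule.coe_add, map_add]; abel
  map_smul' c r := by simp

/-- `∫_T ⟦μ⟧` over a cell `T` of `Ω_i^d`, where `⟦μ⟧ = -∑_j μ_ij` on `Ω_i^d`. -/
def intJump (d : ℕ) (i : G.I d) (T : Cell d) : Lambdah 𝒯 →ₗ[ℝ] ℝ where
  toFun μ := -∑ j : G.J d i, ∑ M : ↥(𝒯.mortar d i j).cells,
    μ d i j M * volume.real (T.set ∩ M.1.set)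
  map_add' μ μ' := by
    simp only [Pi.add_apply, add_mul, Finset.sum_add_distrib, neg_add]
  map_smul' c μ := by
    simp only [Pi.smul_apply, smul_eq_mul, mul_assoc, ← Finset.mul_sum, RingHom.id_apply, mul_neg]

/-! ## Bilinear forms and operators -/

variable (P : Params G)

/-- The mortar form `(γ Kν⁻¹ λ, μ)_Γ`. -/
def mortarForm : Lambdah 𝒯 →ₗ[ℝ] Lambdah 𝒯 →ₗ[ℝ] ℝ :=
  LinearMap.mk₂ ℝ
    (fun l μ => ∑ d ∈ Finset.range n, ∑ i : G.I d, ∑ j : G.J d i,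
      ∑ M : ↥(𝒯.mortar d i j).cells,
        P.γ d i j * (P.Kν d i j)⁻¹ * volume.real M.1.set * l d i j M * μ d i j M)
    (fun l l' μ => by simp only [Pi.add_apply, mul_add, add_mul, Finset.sum_add_distrib])
    (fun c l μ => by
      simp only [Pi.smul_apply, smul_eq_mul, Finset.mul_sum]
      refine Finset.sum_congr rfl fun _ _ => Finset.sum_congr rfl fun _ _ =>
        Finset.sum_congr rfl fun _ _ => Finset.sum_congr rfl fun _ _ => by ring)
    (fun l μ μ' => by simp only [Pi.add_apply, mul_add, Finset.sum_add_distrib])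
    (fun c l μ => by
      simp only [Pi.smul_apply, smul_eq_mul, Finset.mul_sum]
      refine Finset.sum_congr rfl fun _ _ => Finset.sum_congr rfl fun _ _ =>
        Finset.sum_congr rfl fun _ _ => Finset.sum_congr rfl fun _ _ => by ring)

/-- `(K⁻¹ u, v)_Ω` for piecewise Raviart--Thomas fields. -/
def bulkForm : Broken 𝒯 →ₗ[ℝ] Broken 𝒯 →ₗ[ℝ] ℝ :=
  LinearMap.mk₂ ℝ
    (fun u v => ∑ d ∈ Finset.range n, ∑ k : G.I (d + 1), ∑ T : ↥(𝒯.mesh (d + 1) k).cells,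
      T.1.fluxForm (P.K d k) (u d k T) (v d k T))
    (fun u u' v => by simp [Finset.sum_add_distrib])
    (fun c u v => by simp [Finset.mul_sum])
    (fun u v v' => by simp [Finset.sum_add_distrib])
    (fun c u v => by simp [Finset.mul_sum])

/-- `(K⁻¹ u, v)_{D,Ω}` for piecewise Raviart--Thomas fields. -/
def diagBulkForm : Broken 𝒯 →ₗ[ℝ] Broken 𝒯 →ₗ[ℝ] ℝ :=
  LinearMap.mk₂ ℝ
    (fun u v => ∑ d ∈ Finset.range n, ∑ k : G.I (d + 1), ∑ T : ↥(𝒯.mesh (d + 1) k).cells,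
      T.1.diagFluxForm (P.K d k) (u d k T) (v d k T))
    (fun u u' v => by simp [Finset.sum_add_distrib])
    (fun c u v => by simp [Finset.mul_sum])
    (fun u v v' => by simp [Finset.sum_add_distrib])
    (fun c u v => by simp [Finset.mul_sum])

/-- `A : W_h → W_h'`, `⟨A w, r⟩ = a(w, r)
= (K⁻¹(u_0 + R_h λ), v_0 + R_h μ)_Ω + (γ Kν⁻¹ λ, μ)_Γ`. -/
def opA : Wh 𝒯 →ₗ[ℝ] Dual ℝ (Wh 𝒯) :=
  (bulkForm 𝒯 P).compl₁₂ (totalFlux 𝒯) (totalFlux 𝒯) +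
    (mortarForm 𝒯 P).compl₁₂ (LinearMap.snd ℝ _ _) (LinearMap.snd ℝ _ _)

/-- `D_A : W_h → W_h'`, `⟨D_A w, r⟩ = a^D(w, r)
= (K⁻¹(u_0 + R_h λ), v_0 + R_h μ)_{D,Ω} + (γ Kν⁻¹ λ, μ)_Γ`. -/
def opDA : Wh 𝒯 →ₗ[ℝ] Dual ℝ (Wh 𝒯) :=
  (diagBulkForm 𝒯 P).compl₁₂ (totalFlux 𝒯) (totalFlux 𝒯) +
    (mortarForm 𝒯 P).compl₁₂ (LinearMap.snd ℝ _ _) (LinearMap.snd ℝ _ _)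

/-- `B : W_h → Q_h'`, `⟨B r, q⟩ = b(r, q) = -(q, ∇·(v_0 + R_h μ) + ⟦μ⟧)_Ω`; the divergence lives on
the subdomains of dimension `d + 1`, the jump on those of dimension `d`. -/
def opB : Wh 𝒯 →ₗ[ℝ] Dual ℝ (Qh 𝒯) :=
  LinearMap.mk₂ ℝ
    (fun r q =>
      -(∑ d ∈ Finset.range n, ∑ k : G.I (d + 1), ∑ T : ↥(𝒯.mesh (d + 1) k).cells,
          q (d + 1) k T * T.1.intDiv (totalFlux 𝒯 r d k T) +
        ∑ d ∈ Finset.range n, ∑ i : G.I d, ∑ T : ↥(𝒯.mesh d i).cells,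
          q d i T * intJump 𝒯 d i T.1 r.2))
    (fun r r' q => by
      simp only [map_add, Pi.add_apply, Prod.snd_add, mul_add, Finset.sum_add_distrib]; ring)
    (fun c r q => by
      simp only [map_smul, Pi.smul_apply, Prod.smul_snd, smul_eq_mul, mul_left_comm _ c,
        ← Finset.mul_sum]; ring)
    (fun r q q' => by
      simp only [Pi.add_apply, add_mul, Finset.sum_add_distrib]; ring)
    (fun c r q => by
      simp only [Pi.smul_apply, smul_eq_mul, mul_assoc, ← Finset.mul_sum]; ring)

/-- `Bᵀ : Q_h → W_h'`, `⟨Bᵀ q, r⟩ = b(r, q)`. -/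
def opBT : Qh 𝒯 →ₗ[ℝ] Dual ℝ (Wh 𝒯) := (opB 𝒯).flip

end Spaces

/-! ## Preconditioners -/

section Precond

variable {V V' : Type*} [AddCommMonoid V] [Module ℝ V] [AddCommMonoid V'] [Module ℝ V']

open Classical in
/-- The inverse of a bijective linear operator (and `0` for one that is not bijective). -/
def opInv (L : V →ₗ[ℝ] V') : V' →ₗ[ℝ] V :=
  if h : Function.Bijective L then (LinearEquiv.ofBijective L h).symm.toLinearMap else 0

/-- `H : V' → V` is symmetric positive definite. -/
def IsSPD (H : Dual ℝ V →ₗ[ℝ] V) : Prop :=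
  (∀ f g : Dual ℝ V, f (H g) = g (H f)) ∧ ∀ f : Dual ℝ V, f ≠ 0 → 0 < f (H f)

/-- `c₁ ⟨f, H f⟩ ≤ ⟨f, L⁻¹ f⟩ ≤ c₂ ⟨f, H f⟩` for all `f ∈ V'`. -/
def SpectrallyEquiv (c₁ c₂ : ℝ) (H : Dual ℝ V →ₗ[ℝ] V) (L : V →ₗ[ℝ] Dual ℝ V) : Prop :=
  ∀ f : Dual ℝ V, c₁ * f (H f) ≤ f (opInv L f) ∧ f (opInv L f) ≤ c₂ * f (H f)

/-- The norm `‖v‖_L = ⟨L v, v⟩^{1/2}` of a symmetric positive definite operator `L : V → V'`. -/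
def opNorm (L : V →ₗ[ℝ] Dual ℝ V) (v : V) : ℝ := Real.sqrt (L v v)

/-- The inner product `(x', y')_M = ⟨x', M y'⟩` on the dual `V' × U'` of `V × U`. -/
def dualInner {U : Type*} [AddCommMonoid U] [Module ℝ U]
    (M : (Dual ℝ V × Dual ℝ U) →ₗ[ℝ] V × U) (x y : Dual ℝ V × Dual ℝ U) : ℝ :=
  x.1 (M y).1 + x.2 (M y).2

/-- The norm `‖x'‖_M = (x', x')_M^{1/2}`. -/
def dualNorm {U : Type*} [AddCommMonoid U] [Module ℝ U]
    (M : (Dual ℝ V × Dual ℝ U) →ₗ[ℝ] V × U) (x : Dual ℝ V × Dual ℝ U) : ℝ :=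
  Real.sqrt (dualInner M x x)

variable {n : ℕ} {G : Geometry n} (𝒯 : Discretization G) (P : Params G)

/-- `B D_A⁻¹ Bᵀ : Q_h → Q_h'`. -/
def opS : Qh 𝒯 →ₗ[ℝ] Dual ℝ (Qh 𝒯) := opB 𝒯 ∘ₗ opInv (opDA 𝒯 P) ∘ₗ opBT 𝒯

/-- The saddle point operator `(w, p) ↦ (A w + Bᵀ p, -B w)`. -/
def saddle : (Wh 𝒯 × Qh 𝒯) →ₗ[ℝ] Dual ℝ (Wh 𝒯) × Dual ℝ (Qh 𝒯) :=
  ((opA 𝒯 P).coprod (opBT 𝒯)).prod ((-(opB 𝒯)).comp (LinearMap.fst ℝ _ _))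

/-- The block diagonal preconditioner `M_D = diag(H_w, H_p)`. -/
def precondD (Hw : Dual ℝ (Wh 𝒯) →ₗ[ℝ] Wh 𝒯) (Hp : Dual ℝ (Qh 𝒯) →ₗ[ℝ] Qh 𝒯) :
    (Dual ℝ (Wh 𝒯) × Dual ℝ (Qh 𝒯)) →ₗ[ℝ] Wh 𝒯 × Qh 𝒯 :=
  Hw.prodMap Hp

/-- The block upper triangular operator `(w, p) ↦ (H_w⁻¹ w + Bᵀ p, H_p⁻¹ p)`. -/
def upperBlock (Hw : Dual ℝ (Wh 𝒯) →ₗ[ℝ] Wh 𝒯) (Hp : Dual ℝ (Qh 𝒯) →ₗ[ℝ] Qh 𝒯) :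
    (Wh 𝒯 × Qh 𝒯) →ₗ[ℝ] Dual ℝ (Wh 𝒯) × Dual ℝ (Qh 𝒯) :=
  ((opInv Hw).coprod (opBT 𝒯)).prod ((opInv Hp).comp (LinearMap.snd ℝ _ _))

/-- The inexact block upper triangular preconditioner `M_U`, the inverse of `upperBlock`. -/
def precondU (Hw : Dual ℝ (Wh 𝒯) →ₗ[ℝ] Wh 𝒯) (Hp : Dual ℝ (Qh 𝒯) →ₗ[ℝ] Qh 𝒯) :
    (Dual ℝ (Wh 𝒯) × Dual ℝ (Qh 𝒯)) →ₗ[ℝ] Wh 𝒯 × Qh 𝒯 :=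
  opInv (upperBlock 𝒯 Hw Hp)

end Precond

end FracturedFlow

end

/-!
On a shape-regular simplex the Raviart–Thomas field with given normal components is controlled
from below on a ball of comparable volume, and the basis fields are bounded; hence the diagonal
form `a^D` and the form `a` are equivalent, cell by cell, with constants depending only on `n`, `σ`
and `κ`. Passing to inverses reverses inequalities between forms, so `B A⁻¹ Bᵀ` and `B D_A⁻¹ Bᵀ` are
equivalent too, and the hypothesis on `H_p` becomes one on the true Schur complement.

For `w = H_w f` and `p = H_p e` the vector `𝓜_U⁻¹ (w, p)` is `(f + Bᵀ p, e)`. By spectral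
equivalence its squared norm is comparable with the energy `⟨A w, w⟩ + ⟨Bᵀ p, H_w Bᵀ p⟩`, which also
bounds the squared norm of `𝓐 (w, p)`. The numerator of the field of values is the energy plus the
cross term `⟨A w, H_w Bᵀ p⟩`, which is absorbed as soon as `c_{1,w} > 1/4`. The contraction
`‖I - H_w A‖_A ≤ ρ` provides this, since it allows `c_{1,w} = 1 / (1 + ρ) > 1/2`.
-/

namespace FracturedFlow

/-! ### Symmetric positive semidefinite forms -/

section PosSemidef

variable {V : Type*} [AddCommGroup V] [Module ℝ V] {L : V →ₗ[ℝ] V →ₗ[ℝ] ℝ}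

lemma apply_le_mul_apply_of_self_le (hL : L.IsPosSemidef) {c : ℝ} (hc : 0 < c) {u v : V}
    (h : L u u ≤ c * L u v) : L u v ≤ c * L v v := by
  have hnonneg := hL.nonneg (u - c • v)
  have hsymm : L u v = L v u := hL.eq u v
  simp only [map_sub, map_smul, LinearMap.sub_apply, LinearMap.smul_apply,
    smul_eq_mul, ← hsymm] at hnonneg
  refine le_of_mul_le_mul_left ?_ hc
  linarith

lemma apply_add_self_le (hL : L.IsPosSemidef) (u v : V) :
    L (u + v) (u + v) ≤ 2 * L u u + 2 * L v v := by
  have hnonneg := hL.nonneg (u - v)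
  simp only [map_sub, map_add, LinearMap.sub_apply, LinearMap.add_apply] at hnonneg ⊢
  linarith

lemma apply_sum_self_le_card_mul {ι : Type*} [Fintype ι] (hL : L.IsPosSemidef) (x : ι → V) :
    L (∑ i, x i) (∑ i, x i) ≤ Fintype.card ι * ∑ i, L (x i) (x i) := by
  have hpair (i j : ι) : L (x i) (x j) ≤ (L (x i) (x i) + L (x j) (x j)) / 2 := by
    have hnonneg := hL.nonneg (x i - x j)
    have hsymm : L (x i) (x j) = L (x j) (x i) := hL.eq _ _
    simp only [map_sub, LinearMap.sub_apply] at hnonneg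
    linarith
  calc L (∑ i, x i) (∑ i, x i) = ∑ j, ∑ i, L (x i) (x j) := by
        simp only [map_sum, LinearMap.sum_apply]
    _ ≤ ∑ j, ∑ i, (L (x i) (x i) + L (x j) (x j)) / 2 := by gcongr; exact hpair _ _
    _ = Fintype.card ι * ∑ i, L (x i) (x i) := by
        simp only [← Finset.sum_div, Finset.sum_add_distrib, Finset.sum_const, Finset.card_univ,
          nsmul_eq_mul, ← Finset.mul_sum]
        ring

lemma isPosSemidef_compl₁₂ {W : Type*} [AddCommGroup W] [Module ℝ W] (hL : L.IsPosSemidef)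
    (f : W →ₗ[ℝ] V) : (L.compl₁₂ f f).IsPosSemidef where
  eq u v := hL.eq (f u) (f v)
  nonneg u := hL.nonneg (f u)

lemma bijective_of_pos [FiniteDimensional ℝ V] {A : V →ₗ[ℝ] Dual ℝ V}
    (hA : ∀ v, v ≠ 0 → 0 < A v v) : Function.Bijective A := by
  have hinj : Function.Injective A := by
    refine (injective_iff_map_eq_zero A).2 fun v hv => ?_
    by_contra hne
    simpa [hv] using hA v hne
  exact ⟨hinj, (LinearMap.injective_iff_surjective_of_finrank_eq_finrank
    Subspace.dual_finrank_eq.symm).1 hinj⟩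

end PosSemidef

/-! ### Inverses and spectral equivalence -/

section Inverse

lemma opInv_apply_self {V V' : Type*} [AddCommMonoid V] [Module ℝ V] [AddCommMonoid V']
    [Module ℝ V'] {L : V →ₗ[ℝ] V'} (hL : Function.Bijective L) (v : V) : opInv L (L v) = v := by
  rw [opInv, dif_pos hL]
  exact (LinearEquiv.ofBijective L hL).symm_apply_apply v

lemma apply_opInv {V V' : Type*} [AddCommMonoid V] [Module ℝ V] [AddCommMonoid V']
    [Module ℝ V'] {L : V →ₗ[ℝ] V'} (hL : Function.Bijective L) (f : V') : L (opInv L f) = f := by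
  rw [opInv, dif_pos hL]
  exact (LinearEquiv.ofBijective L hL).apply_symm_apply f

variable {V : Type*} [AddCommGroup V] [Module ℝ V] {H : Dual ℝ V →ₗ[ℝ] V}
  {A D : V →ₗ[ℝ] Dual ℝ V} {c c₁ c₂ : ℝ}

lemma isPosSemidef_eval_comp_opInv (hA : A.IsPosSemidef) (hbij : Function.Bijective A) :
    (Dual.eval ℝ V ∘ₗ opInv A).IsPosSemidef where
  eq f g := by
    change g (opInv A f) = f (opInv A g)
    conv_lhs => rw [← apply_opInv hbij g]
    conv_rhs => rw [← apply_opInv hbij f]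
    exact hA.eq _ _
  nonneg f := by
    have := hA.nonneg (opInv A f)
    rwa [apply_opInv hbij] at this

lemma apply_opInv_le_of_le (hA : A.IsPosSemidef) (hAbij : Function.Bijective A)
    (hDbij : Function.Bijective D) (hc : 0 < c) (hAD : ∀ v, A v v ≤ c * D v v) (f : Dual ℝ V) :
    f (opInv D f) ≤ c * f (opInv A f) := by
  have hsymm : A (opInv D f) (opInv A f) = A (opInv A f) (opInv D f) := hA.eq _ _
  have hself := hAD (opInv D f)
  rw [apply_opInv hAbij] at hsymm
  rw [apply_opInv hDbij, ← hsymm] at hself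
  have := apply_le_mul_apply_of_self_le hA hc hself
  rwa [hsymm, apply_opInv hAbij] at this

namespace IsSPD

lemma isPosSemidef (hH : IsSPD H) : (Dual.eval ℝ V ∘ₗ H).IsPosSemidef where
  eq f g := hH.1 g f
  nonneg f := by
    rcases eq_or_ne f 0 with rfl | hf
    · simp
    · exact (hH.2 f hf).le

lemma apply_nonneg (hH : IsSPD H) (f : Dual ℝ V) : 0 ≤ f (H f) := hH.isPosSemidef.nonneg f

lemma apply_add_le (hH : IsSPD H) (f g : Dual ℝ V) :
    (f + g) (H (f + g)) ≤ 2 * f (H f) + 2 * g (H g) :=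
  apply_add_self_le hH.isPosSemidef f g

lemma bijective [FiniteDimensional ℝ V] (hH : IsSPD H) : Function.Bijective H := by
  have hinj : Function.Injective H := by
    refine (injective_iff_map_eq_zero H).2 fun f hf => ?_
    by_contra hne
    simpa [hf] using hH.2 f hne
  exact ⟨hinj, (LinearMap.injective_iff_surjective_of_finrank_eq_finrank
    Subspace.dual_finrank_eq).1 hinj⟩

end IsSPD

namespace SpectrallyEquiv

lemma bijective (h : SpectrallyEquiv c₁ c₂ H A) (hc₁ : 0 < c₁) (hH : IsSPD H) :
    Function.Bijective A := by
  by_contra hA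
  -- `opInv A = 0` then bounds `H` by `0`, so the dual space is trivial.
  have hdual (f : Dual ℝ V) : f = 0 := by
    by_contra hf
    have hle := (h f).1
    rw [opInv, dif_neg hA, LinearMap.zero_apply, map_zero] at hle
    exact (mul_pos hc₁ (hH.2 f hf)).not_ge hle
  have hzero (v : V) : v = 0 :=
    (forall_dual_apply_eq_zero_iff ℝ v).1 fun f => by rw [hdual f, LinearMap.zero_apply]
  exact hA ⟨fun u v _ => by rw [hzero u, hzero v], fun f => ⟨0, by rw [hdual f, map_zero]⟩⟩

lemma pos (h : SpectrallyEquiv c₁ c₂ H A) (hc₁ : 0 < c₁) (hH : IsSPD H) {v : V} (hv : v ≠ 0) :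
    0 < A v v := by
  have hbij := h.bijective hc₁ hH
  have hAv : A v ≠ 0 := fun h0 => hv (hbij.1 (by rw [h0, map_zero]))
  have hle := (h (A v)).1
  rw [opInv_apply_self hbij] at hle
  exact (mul_pos hc₁ (hH.2 _ hAv)).trans_le hle

lemma apply_apply_le (h : SpectrallyEquiv c₁ c₂ H A) (hc₁ : 0 < c₁) (hH : IsSPD H) (v : V) :
    A v (H (A v)) ≤ c₁⁻¹ * A v v := by
  have hle := (h (A v)).1
  rwa [opInv_apply_self (h.bijective hc₁ hH), ← le_inv_mul_iff₀ hc₁] at hle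

lemma form_apply_le (h : SpectrallyEquiv c₁ c₂ H A) (hc₁ : 0 < c₁) (hH : IsSPD H)
    (f : Dual ℝ V) : A (H f) (H f) ≤ c₁⁻¹ * f (H f) := by
  have hself := h.apply_apply_le hc₁ hH (H f)
  have hsymm : A (H f) (H f) = f (H (A (H f))) := hH.1 _ _
  rw [hsymm] at hself ⊢
  exact apply_le_mul_apply_of_self_le hH.isPosSemidef (inv_pos.2 hc₁) hself

lemma apply_le_form (h : SpectrallyEquiv c₁ c₂ H A) (hc₁ : 0 < c₁) (hc₂ : 0 < c₂)
    (hH : IsSPD H) (hA : A.IsPosSemidef) (f : Dual ℝ V) : f (H f) ≤ c₂ * A (H f) (H f) := by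
  have hinv := apply_opInv (h.bijective hc₁ hH) f
  have hself : A (opInv A f) (opInv A f) ≤ c₂ * A (opInv A f) (H f) := by
    rw [hinv]
    exact (h f).2
  simpa only [hinv] using apply_le_mul_apply_of_self_le hA hc₂ hself

lemma of_le [FiniteDimensional ℝ V] {α β : ℝ} (h : SpectrallyEquiv c₁ c₂ H A) (hc₁ : 0 < c₁)
    (hα : 0 < α) (hβ : 0 < β) (hH : IsSPD H) (hA : A.IsPosSemidef) (hD : D.IsPosSemidef)
    (hAD : ∀ v, A v v ≤ α * D v v) (hDA : ∀ v, D v v ≤ β * A v v) :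
    SpectrallyEquiv (β⁻¹ * c₁) (α * c₂) H D := by
  have hAbij := h.bijective hc₁ hH
  have hDbij : Function.Bijective D := bijective_of_pos fun v hv =>
    pos_of_mul_pos_right ((h.pos hc₁ hH hv).trans_le (hAD v)) hα.le
  intro f
  constructor
  · rw [mul_assoc, inv_mul_le_iff₀ hβ]
    exact (h f).1.trans (apply_opInv_le_of_le hD hDbij hAbij hβ hDA f)
  · rw [mul_assoc]
    exact (apply_opInv_le_of_le hA hAbij hDbij hα hAD f).trans (by gcongr; exact (h f).2)

/-- With `f = A y`, the quantity `⟨f, H f⟩` is `⟨A y, y⟩ - ⟨A y, y - H A y⟩`, and the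
contraction bounds the second term by Cauchy–Schwarz. -/
lemma of_contraction {ρ : ℝ} (h : SpectrallyEquiv c₁ c₂ H A) (hc₁ : 0 < c₁) (hH : IsSPD H)
    (hA : A.IsPosSemidef) (hρ : -1 < ρ)
    (hcontr : ∀ v, opNorm A (v - H (A v)) ≤ ρ * opNorm A v) :
    SpectrallyEquiv (1 + ρ)⁻¹ c₂ H A := by
  refine fun f => ⟨?_, (h f).2⟩
  obtain ⟨y, rfl⟩ := (h.bijective hc₁ hH).2 f
  rw [opInv_apply_self (h.bijective hc₁ hH), inv_mul_le_iff₀ (by linarith)]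
  have hcs : |A y (y - H (A y))| ≤ opNorm A y * opNorm A (y - H (A y)) := by
    rw [opNorm, opNorm, ← Real.sqrt_mul (hA.nonneg y)]
    exact Real.abs_le_sqrt (LinearMap.BilinForm.apply_sq_le_of_symm A hA.nonneg
      ⟨hA.eq⟩ y _)
  calc A y (H (A y)) = A y y - A y (y - H (A y)) := by rw [map_sub]; ring
    _ ≤ A y y + opNorm A y * opNorm A (y - H (A y)) := by linarith [neg_le_of_abs_le hcs]
    _ ≤ A y y + opNorm A y * (ρ * opNorm A y) := by
        gcongr
        · exact Real.sqrt_nonneg _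
        · exact hcontr y
    _ = (1 + ρ) * A y y := by
        rw [mul_left_comm, opNorm, Real.mul_self_sqrt (hA.nonneg y)]
        ring

end SpectrallyEquiv

end Inverse

/-! ### Field of values of the preconditioned saddle point operator -/

section Saddle

variable {V U : Type*} [AddCommGroup V] [Module ℝ V] [AddCommGroup U] [Module ℝ U]
  {A D : V →ₗ[ℝ] Dual ℝ V} {B : V →ₗ[ℝ] Dual ℝ U}
  {Hw : Dual ℝ V →ₗ[ℝ] V} {Hp : Dual ℝ U →ₗ[ℝ] U} {c₁w c₂w c₁p c₂p : ℝ}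

/-- The Schur complement `B A⁻¹ Bᵀ`. -/
noncomputable def schur (A : V →ₗ[ℝ] Dual ℝ V) (B : V →ₗ[ℝ] Dual ℝ U) : U →ₗ[ℝ] Dual ℝ U :=
  B ∘ₗ opInv A ∘ₗ B.flip

lemma isPosSemidef_schur (hA : A.IsPosSemidef) (hbij : Function.Bijective A) :
    (schur A B).IsPosSemidef :=
  isPosSemidef_compl₁₂ (isPosSemidef_eval_comp_opInv hA hbij) B.flip

lemma SpectrallyEquiv.schur_of_le [FiniteDimensional ℝ U] {α β : ℝ}
    (h : SpectrallyEquiv c₁p c₂p Hp (schur D B)) (hc₁p : 0 < c₁p) (hα : 0 < α) (hβ : 0 < β)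
    (hHp : IsSPD Hp) (hA : A.IsPosSemidef) (hAbij : Function.Bijective A)
    (hD : D.IsPosSemidef) (hDbij : Function.Bijective D)
    (hAD : ∀ v, A v v ≤ α * D v v) (hDA : ∀ v, D v v ≤ β * A v v) :
    SpectrallyEquiv (β⁻¹ * c₁p) (α * c₂p) Hp (schur A B) :=
  h.of_le hc₁p hα hβ hHp (isPosSemidef_schur hD hDbij) (isPosSemidef_schur hA hAbij)
    (fun q => apply_opInv_le_of_le hA hAbij hDbij hα hAD (B.flip q))
    (fun q => apply_opInv_le_of_le hD hDbij hAbij hβ hDA (B.flip q))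

/-- The saddle point operator `(w, p) ↦ (A w + Bᵀ p, -B w)`. -/
def saddleOp (A : V →ₗ[ℝ] Dual ℝ V) (B : V →ₗ[ℝ] Dual ℝ U) :
    V × U →ₗ[ℝ] Dual ℝ V × Dual ℝ U :=
  (A.coprod B.flip).prod ((-B).comp (LinearMap.fst ℝ V U))

/-- The block upper triangular operator `(w, p) ↦ (Hw⁻¹ w + Bᵀ p, Hp⁻¹ p)`. -/
noncomputable def triangularOp (Hw : Dual ℝ V →ₗ[ℝ] V) (Hp : Dual ℝ U →ₗ[ℝ] U)
    (B : V →ₗ[ℝ] Dual ℝ U) : V × U →ₗ[ℝ] Dual ℝ V × Dual ℝ U :=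
  ((opInv Hw).coprod B.flip).prod ((opInv Hp).comp (LinearMap.snd ℝ V U))

lemma triangularOp_apply (hHw : Function.Bijective Hw) (hHp : Function.Bijective Hp)
    (f : Dual ℝ V) (e : Dual ℝ U) :
    triangularOp Hw Hp B (Hw f, Hp e) = (f + B.flip (Hp e), e) :=
  Prod.ext (congrArg (· + B.flip (Hp e)) (opInv_apply_self hHw f)) (opInv_apply_self hHp e)

lemma triangularOp_bijective (hHw : Function.Bijective Hw) (hHp : Function.Bijective Hp) :
    Function.Bijective (triangularOp Hw Hp B) := by
  constructor
  · rintro ⟨v, u⟩ ⟨v', u'⟩ heq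
    obtain ⟨f, rfl⟩ := hHw.2 v
    obtain ⟨e, rfl⟩ := hHp.2 u
    obtain ⟨f', rfl⟩ := hHw.2 v'
    obtain ⟨e', rfl⟩ := hHp.2 u'
    rw [triangularOp_apply hHw hHp, triangularOp_apply hHw hHp, Prod.mk.injEq] at heq
    obtain ⟨hfirst, rfl⟩ := heq
    rw [add_right_cancel hfirst]
  · rintro ⟨f, e⟩
    exact ⟨(Hw (f - B.flip (Hp e)), Hp e), by rw [triangularOp_apply hHw hHp, sub_add_cancel]⟩

lemma dualInner_prodMap_self_pos (hHw : IsSPD Hw) (hHp : IsSPD Hp) {x : Dual ℝ V × Dual ℝ U}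
    (hx : x ≠ 0) : 0 < dualInner (Hw.prodMap Hp) x x := by
  change 0 < x.1 (Hw x.1) + x.2 (Hp x.2)
  by_cases hfst : x.1 = 0
  · exact add_pos_of_nonneg_of_pos (hHw.apply_nonneg _)
      (hHp.2 _ fun hsnd => hx (Prod.ext hfst hsnd))
  · exact add_pos_of_pos_of_nonneg (hHw.2 _ hfst) (hHp.apply_nonneg _)

/-- The energy `⟨A w, w⟩ + ⟨g, Hw g⟩`, in which the numerators and the denominator of the
field-of-values quotients at `(w, p)` are measured, with `g = Bᵀ p`. -/
def energy (A : V →ₗ[ℝ] Dual ℝ V) (Hw : Dual ℝ V →ₗ[ℝ] V) (w : V) (g : Dual ℝ V) : ℝ :=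
  A w w + g (Hw g)

/-- The cross term `⟨A w, Hw g⟩` is absorbed by expanding `‖w + √c₁w Hw g‖_A² ≥ 0`. -/
lemma mul_energy_le (hA : A.IsPosSemidef) (hHw : IsSPD Hw) (hc₁w : 0 < c₁w)
    (hw : SpectrallyEquiv c₁w c₂w Hw A) (w : V) (g : Dual ℝ V) :
    (1 - 1 / (2 * √c₁w)) * energy A Hw w g ≤ A w w + A w (Hw g) + g (Hw g) := by
  have hs : 0 < √c₁w := Real.sqrt_pos.2 hc₁w
  have hHg : √c₁w * (√c₁w * A (Hw g) (Hw g)) ≤ g (Hw g) := by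
    rw [← mul_assoc, Real.mul_self_sqrt hc₁w.le, ← le_inv_mul_iff₀ hc₁w]
    exact hw.form_apply_le hc₁w hHw g
  have hexpand := hA.nonneg (w + √c₁w • Hw g)
  have hsymm : A (Hw g) w = A w (Hw g) := hA.eq _ _
  simp only [map_add, map_smul, LinearMap.add_apply, LinearMap.smul_apply, smul_eq_mul,
    hsymm] at hexpand
  have hcross : 0 ≤ energy A Hw w g / (2 * √c₁w) + A w (Hw g) := by
    rw [div_add' _ _ _ (mul_pos two_pos hs).ne']
    refine div_nonneg ?_ (mul_pos two_pos hs).le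
    rw [energy]
    linarith
  calc (1 - 1 / (2 * √c₁w)) * energy A Hw w g
      = energy A Hw w g - energy A Hw w g / (2 * √c₁w) := by ring
    _ ≤ energy A Hw w g + A w (Hw g) := by linarith
    _ = A w w + A w (Hw g) + g (Hw g) := by rw [energy]; ring

/-- The ratio by which the energy controls the norm of `triangularOp (w, p)`. -/
def normConst (c₂w c₂p : ℝ) : ℝ := 2 * c₂w + 2 + c₂p * c₂w

/-- The ratio by which the norm of `triangularOp (w, p)` controls the energy. -/
noncomputable def energyConst (c₁w c₁p : ℝ) : ℝ := 2 * c₁w⁻¹ + (2 * c₁w⁻¹ + 1) * (c₁w * c₁p)⁻¹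

/-- The ratio by which the energy controls the norm of `saddleOp (w, p)`. -/
noncomputable def residualConst (c₁w c₁p : ℝ) : ℝ := 2 * c₁w⁻¹ + c₁p⁻¹ + 2

lemma dualInner_le_mul_energy (hA : A.IsPosSemidef) (hHw : IsSPD Hw) (hHp : IsSPD Hp)
    (hc₁w : 0 < c₁w) (hc₂w : 0 < c₂w) (hc₁p : 0 < c₁p) (hc₂p : 0 < c₂p)
    (hw : SpectrallyEquiv c₁w c₂w Hw A) (hp : SpectrallyEquiv c₁p c₂p Hp (schur A B))
    (f : Dual ℝ V) (e : Dual ℝ U) :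
    dualInner (Hw.prodMap Hp) (f + B.flip (Hp e), e) (f + B.flip (Hp e), e) ≤
      normConst c₂w c₂p * energy A Hw (Hw f) (B.flip (Hp e)) := by
  set g := B.flip (Hp e)
  have hf : f (Hw f) ≤ c₂w * A (Hw f) (Hw f) := hw.apply_le_form hc₁w hc₂w hHw hA f
  have he : e (Hp e) ≤ c₂p * (c₂w * g (Hw g)) :=
    (hp.apply_le_form hc₁p hc₂p hHp
      (isPosSemidef_schur hA (hw.bijective hc₁w hHw)) e).trans (by gcongr; exact (hw g).2)
  have hAw := hA.nonneg (Hw f)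
  have hg := hHw.apply_nonneg g
  calc (f + g) (Hw (f + g)) + e (Hp e)
      ≤ (2 * f (Hw f) + 2 * g (Hw g)) + e (Hp e) := by gcongr; exact hHw.apply_add_le f g
    _ ≤ (2 * (c₂w * A (Hw f) (Hw f)) + 2 * g (Hw g)) + c₂p * (c₂w * g (Hw g)) := by gcongr
    _ ≤ normConst c₂w c₂p * energy A Hw (Hw f) g := by
        have hrest : 0 ≤ (2 + c₂p * c₂w) * A (Hw f) (Hw f) + 2 * c₂w * g (Hw g) := by positivity
        rw [normConst, energy]
        linarith

lemma flip_apply_le (hHp : IsSPD Hp) (hc₁w : 0 < c₁w) (hc₁p : 0 < c₁p)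
    (hw : SpectrallyEquiv c₁w c₂w Hw A) (hp : SpectrallyEquiv c₁p c₂p Hp (schur A B))
    (e : Dual ℝ U) :
    B.flip (Hp e) (Hw (B.flip (Hp e))) ≤ (c₁w * c₁p)⁻¹ * e (Hp e) := by
  rw [mul_inv, mul_assoc, le_inv_mul_iff₀ hc₁w]
  exact (hw _).1.trans (hp.form_apply_le hc₁p hHp e)

lemma energy_le_mul_dualInner (hHw : IsSPD Hw) (hHp : IsSPD Hp) (hc₁w : 0 < c₁w)
    (hc₁p : 0 < c₁p) (hw : SpectrallyEquiv c₁w c₂w Hw A)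
    (hp : SpectrallyEquiv c₁p c₂p Hp (schur A B)) (f : Dual ℝ V) (e : Dual ℝ U) :
    energy A Hw (Hw f) (B.flip (Hp e)) ≤ energyConst c₁w c₁p *
      dualInner (Hw.prodMap Hp) (f + B.flip (Hp e), e) (f + B.flip (Hp e), e) := by
  set g := B.flip (Hp e)
  have hg : g (Hw g) ≤ (c₁w * c₁p)⁻¹ * e (Hp e) := flip_apply_le hHp hc₁w hc₁p hw hp e
  have hf : f (Hw f) ≤ 2 * (f + g) (Hw (f + g)) + 2 * g (Hw g) := by
    simpa using hHw.apply_add_le (f + g) (-g)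
  have hfg := hHw.apply_nonneg (f + g)
  have he := hHp.apply_nonneg e
  calc A (Hw f) (Hw f) + g (Hw g) ≤ c₁w⁻¹ * f (Hw f) + g (Hw g) := by
        gcongr
        exact hw.form_apply_le hc₁w hHw f
    _ ≤ c₁w⁻¹ * (2 * (f + g) (Hw (f + g)) + 2 * g (Hw g)) + g (Hw g) := by gcongr
    _ = 2 * c₁w⁻¹ * (f + g) (Hw (f + g)) + (2 * c₁w⁻¹ + 1) * g (Hw g) := by ring
    _ ≤ 2 * c₁w⁻¹ * (f + g) (Hw (f + g)) + (2 * c₁w⁻¹ + 1) * ((c₁w * c₁p)⁻¹ * e (Hp e)) := by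
        gcongr
    _ ≤ energyConst c₁w c₁p * ((f + g) (Hw (f + g)) + e (Hp e)) := by
        have hrest : 0 ≤ (2 * c₁w⁻¹ + 1) * (c₁w * c₁p)⁻¹ * (f + g) (Hw (f + g)) +
          2 * c₁w⁻¹ * e (Hp e) := by positivity
        rw [energyConst]
        linarith

lemma apply_precond_le (hA : A.IsPosSemidef) (hbij : Function.Bijective A) (hHp : IsSPD Hp)
    (hc₁p : 0 < c₁p) (hp : SpectrallyEquiv c₁p c₂p Hp (schur A B)) (w : V) :
    B w (Hp (B w)) ≤ c₁p⁻¹ * A w w := by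
  set u := opInv A (B.flip (Hp (B w)))
  have hAu : A u = B.flip (Hp (B w)) := apply_opInv hbij _
  have hself : A u u ≤ c₁p⁻¹ * A u w := by
    rw [hAu]
    exact hp.form_apply_le hc₁p hHp (B w)
  have hle := apply_le_mul_apply_of_self_le hA (inv_pos.2 hc₁p) hself
  rwa [hAu] at hle

lemma residual_le_mul_energy (hA : A.IsPosSemidef) (hHw : IsSPD Hw) (hHp : IsSPD Hp)
    (hc₁w : 0 < c₁w) (hc₁p : 0 < c₁p) (hw : SpectrallyEquiv c₁w c₂w Hw A)
    (hp : SpectrallyEquiv c₁p c₂p Hp (schur A B)) (w : V) (p : U) :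
    dualInner (Hw.prodMap Hp) (saddleOp A B (w, p)) (saddleOp A B (w, p)) ≤
      residualConst c₁w c₁p * energy A Hw w (B.flip p) := by
  set g := B.flip p
  have hBw := apply_precond_le hA (hw.bijective hc₁w hHw) hHp hc₁p hp w
  have hAw := hA.nonneg w
  have hg := hHw.apply_nonneg g
  calc (A w + g) (Hw (A w + g)) + (-B w) (Hp (-B w))
      = (A w + g) (Hw (A w + g)) + B w (Hp (B w)) := by simp
    _ ≤ (2 * (c₁w⁻¹ * A w w) + 2 * g (Hw g)) + c₁p⁻¹ * A w w := by
        gcongr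
        exact (hHw.apply_add_le _ _).trans (by gcongr; exact hw.apply_apply_le hc₁w hHw w)
    _ ≤ residualConst c₁w c₁p * energy A Hw w g := by
        have hrest : 0 ≤ 2 * A w w + (2 * c₁w⁻¹ + c₁p⁻¹) * g (Hw g) := by positivity
        rw [residualConst, energy]
        linarith

lemma dualInner_saddleOp_eq (f : Dual ℝ V) (e : Dual ℝ U) :
    dualInner (Hw.prodMap Hp) (saddleOp A B (Hw f, Hp e)) (f + B.flip (Hp e), e) =
      A (Hw f) (Hw f) + A (Hw f) (Hw (B.flip (Hp e))) +
        B.flip (Hp e) (Hw (B.flip (Hp e))) := by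
  change (A (Hw f) + B.flip (Hp e)) (Hw (f + B.flip (Hp e))) + (-B (Hw f)) (Hp e) = _
  simp only [map_add, LinearMap.add_apply, LinearMap.neg_apply, LinearMap.flip_apply]
  ring

/-- The lower field-of-values bound of the preconditioned operator. -/
noncomputable def lowerBound (c₁w c₂w c₂p : ℝ) : ℝ :=
  (1 - 1 / (2 * √c₁w)) / normConst c₂w c₂p

/-- The bound of the norm of the preconditioned operator. -/
noncomputable def upperBound (c₁w c₁p : ℝ) : ℝ := √(residualConst c₁w c₁p * energyConst c₁w c₁p)

lemma normConst_pos (hc₂w : 0 < c₂w) (hc₂p : 0 < c₂p) : 0 < normConst c₂w c₂p := by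
  unfold normConst
  positivity

lemma lowerBound_pos (hc₁w : 1 / 4 < c₁w) (hc₂w : 0 < c₂w) (hc₂p : 0 < c₂p) :
    0 < lowerBound c₁w c₂w c₂p := by
  have hsqrt : 1 / 2 < √c₁w := Real.lt_sqrt_of_sq_lt (by linarith)
  refine div_pos (sub_pos.2 ?_) (normConst_pos hc₂w hc₂p)
  rw [div_lt_one (by linarith)]
  linarith

lemma upperBound_pos (hc₁w : 0 < c₁w) (hc₁p : 0 < c₁p) : 0 < upperBound c₁w c₁p := by
  unfold upperBound residualConst energyConst
  positivity

theorem fieldOfValues_bounds [FiniteDimensional ℝ V] [FiniteDimensional ℝ U]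
    (hA : A.IsPosSemidef) (hHw : IsSPD Hw) (hHp : IsSPD Hp)
    (hc₁w : 1 / 4 < c₁w) (hc₂w : 0 < c₂w) (hc₁p : 0 < c₁p) (hc₂p : 0 < c₂p)
    (hw : SpectrallyEquiv c₁w c₂w Hw A) (hp : SpectrallyEquiv c₁p c₂p Hp (schur A B))
    {x : V × U} (hx : x ≠ 0) :
    lowerBound c₁w c₂w c₂p ≤
        dualInner (Hw.prodMap Hp) (saddleOp A B x) (triangularOp Hw Hp B x) /
          dualInner (Hw.prodMap Hp) (triangularOp Hw Hp B x) (triangularOp Hw Hp B x) ∧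
      dualNorm (Hw.prodMap Hp) (saddleOp A B x) /
        dualNorm (Hw.prodMap Hp) (triangularOp Hw Hp B x) ≤ upperBound c₁w c₁p := by
  have hc₁w' : 0 < c₁w := by linarith
  have hx' : triangularOp Hw Hp B x ≠ 0 :=
    (map_ne_zero_iff _ (triangularOp_bijective hHw.bijective hHp.bijective).1).2 hx
  obtain ⟨w, p⟩ := x
  obtain ⟨f, rfl⟩ := hHw.bijective.2 w
  obtain ⟨e, rfl⟩ := hHp.bijective.2 p
  have hpos := dualInner_prodMap_self_pos hHw hHp hx'
  rw [triangularOp_apply hHw.bijective hHp.bijective] at hpos ⊢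
  set N := dualInner (Hw.prodMap Hp) (f + B.flip (Hp e), e) (f + B.flip (Hp e), e)
  set E := energy A Hw (Hw f) (B.flip (Hp e))
  have hN : N ≤ normConst c₂w c₂p * E :=
    dualInner_le_mul_energy hA hHw hHp hc₁w' hc₂w hc₁p hc₂p hw hp f e
  have hE : E ≤ energyConst c₁w c₁p * N := energy_le_mul_dualInner hHw hHp hc₁w' hc₁p hw hp f e
  constructor
  · rw [le_div_iff₀ hpos, dualInner_saddleOp_eq]
    calc lowerBound c₁w c₂w c₂p * N ≤ lowerBound c₁w c₂w c₂p * (normConst c₂w c₂p * E) := by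
          gcongr
          exact (lowerBound_pos hc₁w hc₂w hc₂p).le
      _ = (1 - 1 / (2 * √c₁w)) * E := by
          rw [lowerBound, ← mul_assoc, div_mul_cancel₀ _ (normConst_pos hc₂w hc₂p).ne']
      _ ≤ _ := mul_energy_le hA hHw hc₁w' hw _ _
  · rw [dualNorm, dualNorm, ← Real.sqrt_div' _ hpos.le]
    refine Real.sqrt_le_sqrt ((div_le_iff₀ hpos).2 ?_)
    calc _ ≤ residualConst c₁w c₁p * E := residual_le_mul_energy hA hHw hHp hc₁w' hc₁p hw hp _ _
      _ ≤ residualConst c₁w c₁p * (energyConst c₁w c₁p * N) := by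
          gcongr
          unfold residualConst
          positivity
      _ = residualConst c₁w c₁p * energyConst c₁w c₁p * N := (mul_assoc _ _ _).symm

end Saddle

/-! ### Lowest-order Raviart–Thomas fields on a simplex -/

namespace Cell

variable {d : ℕ} (T : Cell (d + 1))

lemma norm_normal (f : Fin (d + 2)) : ‖T.normal f‖ = 1 := by
  have hpos := T.height_pos f
  rw [Cell.normal, norm_smul, norm_inv, Real.norm_of_nonneg hpos.le, ← dist_eq_norm, dist_comm]
  exact inv_mul_cancel₀ hpos.ne'

lemma inner_sub_normal {f g : Fin (d + 2)} (hgf : g ≠ f) :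
    inner ℝ (T.points g - T.points f) (T.normal f) = T.height f := by
  have hinner := T.inner_vsub_vsub_altitudeFoot_eq_height_sq hgf.symm
  have hpos := T.height_pos f
  rw [vsub_eq_sub, vsub_eq_sub] at hinner
  rw [Cell.normal, real_inner_smul_right, ← neg_sub (T.points f), ← neg_sub (T.points f),
    inner_neg_neg, hinner]
  field_simp

lemma inner_centroid_sub_normal (f : Fin (d + 2)) :
    inner ℝ (T.faceOppositeCentroid f - T.points f) (T.normal f) = T.height f := by
  have hcentroid := T.faceOppositeCentroid_vsub_point_eq_smul_sum_vsub f
  simp only [vsub_eq_sub] at hcentroid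
  rw [hcentroid, real_inner_smul_left, sum_inner, ← Finset.add_sum_erase _ _ (Finset.mem_univ f),
    Finset.sum_congr rfl fun g hg => T.inner_sub_normal (Finset.ne_of_mem_erase hg), sub_self,
    inner_zero_left, zero_add, Finset.sum_const, Finset.card_erase_of_mem (Finset.mem_univ f),
    Finset.card_univ, Fintype.card_fin, Nat.add_one_sub_one, nsmul_eq_mul]
  exact inv_mul_cancel_left₀ (Nat.cast_ne_zero.2 d.succ_ne_zero) _

lemma normalComp_basisField (f g : Fin (d + 2)) :
    T.normalComp g (T.basisField f) = if g = f then 1 else 0 := by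
  have hpos := T.height_pos f
  change inner ℝ ((T.height f)⁻¹ • (T.faceOppositeCentroid g - T.points f)) (T.normal g) = _
  rw [real_inner_smul_left]
  split_ifs with hgf
  · subst hgf
    rw [T.inner_centroid_sub_normal, inv_mul_cancel₀ hpos.ne']
  · rw [← sub_sub_sub_cancel_right _ _ (T.points g), inner_sub_left,
      T.inner_centroid_sub_normal, T.inner_sub_normal (Ne.symm hgf), sub_self, mul_zero]

end Cell

namespace RT0

lemma exists_eq_add_smul_sub {d : ℕ} (v : RT0 d) (c : Vec d) :
    ∃ s : ℝ, ∀ x, (v : Vec d → Vec d) x = (v : Vec d → Vec d) c + s • (x - c) := by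
  obtain ⟨v, m, s, hv⟩ := v
  refine ⟨s, fun x => ?_⟩
  change v x = v c + s • (x - c)
  rw [hv, hv, smul_sub]
  abel

/-- The parametrization `(m, s) ↦ (x ↦ m + s x)` of the local Raviart–Thomas space. -/
def ofCoeffs (d : ℕ) : Vec d × ℝ →ₗ[ℝ] RT0 d where
  toFun c := ⟨fun x => c.1 + c.2 • x, c.1, c.2, fun _ => rfl⟩
  map_add' c c' := by
    ext1; funext x
    simp only [Prod.fst_add, Prod.snd_add, add_smul, Submodule.coe_add, Pi.add_apply]
    abel
  map_smul' a c := by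
    ext1; funext x
    simp [mul_smul]

lemma ofCoeffs_surjective (d : ℕ) : Function.Surjective (ofCoeffs d) := by
  rintro ⟨v, m, s, hv⟩
  exact ⟨(m, s), Subtype.ext (funext fun x => (hv x).symm)⟩

instance (d : ℕ) : FiniteDimensional ℝ (RT0 d) :=
  Module.Finite.of_surjective _ (ofCoeffs_surjective d)

lemma finrank_le (d : ℕ) : finrank ℝ (RT0 d) ≤ d + 1 := by
  simpa using LinearMap.finrank_le_finrank_of_surjective (ofCoeffs_surjective d)

end RT0

namespace Cell

variable {d : ℕ} (T : Cell (d + 1))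

lemma normalComp_sum_basisField (c : Fin (d + 2) → ℝ) (g : Fin (d + 2)) :
    T.normalComp g (∑ f, c f • T.basisField f) = c g := by
  simp [normalComp_basisField]

lemma sum_normalComp_smul_basisField (v : RT0 (d + 1)) :
    ∑ f, T.normalComp f v • T.basisField f = v := by
  let Φ : RT0 (d + 1) →ₗ[ℝ] (Fin (d + 2) → ℝ) := LinearMap.pi T.normalComp
  have hsurj : Function.Surjective Φ := fun c =>
    ⟨∑ f, c f • T.basisField f, funext (T.normalComp_sum_basisField c)⟩
  have hfinrank : finrank ℝ (RT0 (d + 1)) = finrank ℝ (Fin (d + 2) → ℝ) :=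
    le_antisymm ((RT0.finrank_le (d + 1)).trans (by simp))
      (LinearMap.finrank_le_finrank_of_surjective hsurj)
  exact (LinearMap.injective_iff_surjective_of_finrank_eq_finrank hfinrank).2 hsurj
    (funext (T.normalComp_sum_basisField _))

lemma inner_sub_point_mem_Icc (f : Fin (d + 2)) {x : Vec (d + 1)} (hx : x ∈ T.set) :
    inner ℝ (x - T.points f) (T.normal f) ∈ Set.Icc 0 (T.height f) := by
  let L : Vec (d + 1) →ₗ[ℝ] ℝ := (innerₗ (Vec (d + 1))).flip (T.normal f)
  have hsub (y : Vec (d + 1)) :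
      inner ℝ (y - T.points f) (T.normal f) = L y - L (T.points f) := inner_sub_left ..
  have hmem : x ∈ L ⁻¹' Set.Icc (L (T.points f)) (L (T.points f) + T.height f) := by
    refine convexHull_min ?_ ((convex_Icc _ _).linear_preimage L) hx
    rintro _ ⟨g, rfl⟩
    have hpos := T.height_pos f
    rcases eq_or_ne g f with rfl | hgf
    · exact ⟨le_rfl, by linarith⟩
    · have heq := T.inner_sub_normal hgf
      rw [hsub] at heq
      constructor <;> linarith
  rw [hsub]
  constructor <;> linarith [hmem.1, hmem.2]

lemma radius_le_height {c : Vec (d + 1)} {r : ℝ} (hr : 0 ≤ r)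
    (hball : Metric.closedBall c r ⊆ T.set) (f : Fin (d + 2)) : r ≤ T.height f := by
  have hcenter := T.inner_sub_point_mem_Icc f (hball (Metric.mem_closedBall_self hr))
  have htop : c + r • T.normal f ∈ T.set :=
    hball (by simp [norm_smul, T.norm_normal, abs_of_nonneg hr])
  have htop' := T.inner_sub_point_mem_Icc f htop
  rw [add_sub_right_comm, inner_add_left, real_inner_smul_left, real_inner_self_eq_norm_sq,
    T.norm_normal] at htop'
  linarith [hcenter.1, htop'.2]

lemma points_mem (f : Fin (d + 2)) : T.points f ∈ T.set :=
  subset_convexHull ℝ _ (Set.mem_range_self f)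

lemma faceOppositeCentroid_mem (f : Fin (d + 2)) : T.faceOppositeCentroid f ∈ T.set := by
  have hweights : ∑ g ∈ ({f}ᶜ : Finset (Fin (d + 2))), ((d + 1 : ℕ) : ℝ)⁻¹ = 1 := by
    rw [Finset.sum_const, Finset.card_compl, Fintype.card_fin, Finset.card_singleton,
      Nat.add_one_sub_one, nsmul_eq_mul]
    exact mul_inv_cancel₀ (Nat.cast_ne_zero.2 d.succ_ne_zero)
  rw [T.faceOppositeCentroid_eq_affineCombination f]
  exact convexHull_mono (Set.range_subset_iff.2 fun g => Set.mem_range_self g)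
    (affineCombination_mem_convexHull (fun g _ => by positivity) hweights)

lemma norm_sub_le_diam {x y : Vec (d + 1)} (hx : x ∈ T.set) (hy : y ∈ T.set) :
    ‖x - y‖ ≤ Metric.diam T.set := by
  rw [← dist_eq_norm]
  exact Metric.dist_le_diam_of_mem T.isCompact_set.isBounded hx hy

lemma norm_basisField_le {c : Vec (d + 1)} {r σ : ℝ} (hr : 0 ≤ r) (hσ : 0 ≤ σ)
    (hball : Metric.closedBall c r ⊆ T.set) (hdiam : Metric.diam T.set ≤ σ * r)
    (f : Fin (d + 2)) {x : Vec (d + 1)} (hx : x ∈ T.set) :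
    ‖(T.basisField f : Vec (d + 1) → Vec (d + 1)) x‖ ≤ σ := by
  have hpos := T.height_pos f
  change ‖(T.height f)⁻¹ • (x - T.points f)‖ ≤ σ
  rw [norm_smul, norm_inv, Real.norm_of_nonneg hpos.le, inv_mul_le_iff₀ hpos, mul_comm]
  calc ‖x - T.points f‖ ≤ σ * r := (T.norm_sub_le_diam hx (T.points_mem f)).trans hdiam
    _ ≤ σ * T.height f := by gcongr; exact T.radius_le_height hr hball f

lemma abs_normalComp_le {v : RT0 (d + 1)} {c : Vec (d + 1)} {s : ℝ} (hc : c ∈ T.set)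
    (hv : ∀ x, (v : Vec (d + 1) → Vec (d + 1)) x =
      (v : Vec (d + 1) → Vec (d + 1)) c + s • (x - c)) (f : Fin (d + 2)) :
    |T.normalComp f v| ≤
      ‖(v : Vec (d + 1) → Vec (d + 1)) c‖ + |s| * Metric.diam T.set := by
  set y := T.faceOppositeCentroid f
  calc |inner ℝ ((v : Vec (d + 1) → Vec (d + 1)) y) (T.normal f)|
      ≤ ‖(v : Vec (d + 1) → Vec (d + 1)) y‖ * ‖T.normal f‖ := abs_real_inner_le_norm _ _
    _ = ‖(v : Vec (d + 1) → Vec (d + 1)) c + s • (y - c)‖ := by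
        rw [T.norm_normal, mul_one, ← hv]
    _ ≤ ‖(v : Vec (d + 1) → Vec (d + 1)) c‖ + |s| * ‖y - c‖ := by
        rw [← Real.norm_eq_abs, ← norm_smul]
        exact norm_add_le _ _
    _ ≤ ‖(v : Vec (d + 1) → Vec (d + 1)) c‖ + |s| * Metric.diam T.set := by
        gcongr
        exact T.norm_sub_le_diam (T.faceOppositeCentroid_mem f) hc

end Cell

/-! ### Inverse permeabilities -/

section Permeability

lemma isPosSemidef_innerₗ_comp {E : Type*} [NormedAddCommGroup E] [InnerProductSpace ℝ E]
    {S : E →ₗ[ℝ] E} (hS : S.IsPositive) : (innerₗ E ∘ₗ S).IsPosSemidef where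
  eq x y := (hS.isSymmetric x y).trans (real_inner_comm _ _)
  nonneg x := hS.inner_nonneg_left x

variable {ι : Type*} [Fintype ι] [DecidableEq ι] {K : Matrix ι ι ℝ}

lemma isPosSemidef_inner_toEuclideanLin (hK : K.PosDef) :
    (innerₗ (EuclideanSpace ℝ ι) ∘ₗ Matrix.toEuclideanLin K).IsPosSemidef :=
  isPosSemidef_innerₗ_comp (Matrix.isPositive_toEuclideanLin_iff.2 hK.posSemidef)

lemma toEuclideanLin_toEuclideanLin_inv (hK : K.PosDef) (x : EuclideanSpace ℝ ι) :
    Matrix.toEuclideanLin K (Matrix.toEuclideanLin K⁻¹ x) = x := by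
  simp [Matrix.toLpLin_apply, Matrix.mulVec_mulVec,
    Matrix.mul_nonsing_inv _ hK.det_pos.ne'.isUnit]

lemma inner_toEuclideanLin_inv_le (hK : K.PosDef) {m : ℝ} (hm : 0 < m)
    (hle : ∀ x, m * ‖x‖ ^ 2 ≤ inner ℝ (Matrix.toEuclideanLin K x) x) (x : EuclideanSpace ℝ ι) :
    inner ℝ (Matrix.toEuclideanLin K⁻¹ x) x ≤ m⁻¹ * ‖x‖ ^ 2 := by
  set w := Matrix.toEuclideanLin K⁻¹ x with hw
  have hself : inner ℝ w w ≤ m⁻¹ * inner ℝ w x := by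
    have hle_w := hle w
    rwa [hw, toEuclideanLin_toEuclideanLin_inv hK, ← hw, ← real_inner_self_eq_norm_sq,
      real_inner_comm w x, ← le_inv_mul_iff₀ hm] at hle_w
  rw [← real_inner_self_eq_norm_sq]
  have hinner := isPosSemidef_innerₗ_comp (E := EuclideanSpace ℝ ι) LinearMap.isPositive_id
  exact apply_le_mul_apply_of_self_le hinner (inv_pos.2 hm) (u := w) (v := x) hself

lemma le_inner_toEuclideanLin_inv (hK : K.PosDef) {M : ℝ} (hM : 0 < M)
    (hle : ∀ x, inner ℝ (Matrix.toEuclideanLin K x) x ≤ M * ‖x‖ ^ 2) (x : EuclideanSpace ℝ ι) :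
    M⁻¹ * ‖x‖ ^ 2 ≤ inner ℝ (Matrix.toEuclideanLin K⁻¹ x) x := by
  set w := Matrix.toEuclideanLin K⁻¹ x
  have hw : Matrix.toEuclideanLin K w = x := toEuclideanLin_toEuclideanLin_inv hK x
  have hx : inner ℝ (Matrix.toEuclideanLin K x) w = ‖x‖ ^ 2 := by
    rw [← real_inner_self_eq_norm_sq, ← hw]
    exact (isPosSemidef_inner_toEuclideanLin hK).eq _ _
  rw [inv_mul_le_iff₀ hM, real_inner_comm, ← hx]
  have := apply_le_mul_apply_of_self_le (isPosSemidef_inner_toEuclideanLin hK) hM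
    (u := x) (v := w) ((hle x).trans_eq (by rw [← hx]; rfl))
  rwa [LinearMap.comp_apply, LinearMap.comp_apply, hw] at this

end Permeability

/-! ### The element forms -/

lemma exists_norm_eq_one_sameRay_smul {E : Type*} [NormedAddCommGroup E] [NormedSpace ℝ E]
    [Nontrivial E] (a : E) (s : ℝ) : ∃ e : E, ‖e‖ = 1 ∧ SameRay ℝ a (s • e) := by
  obtain ⟨e, he, hae⟩ : ∃ e : E, ‖e‖ = 1 ∧ SameRay ℝ a e := by
    by_cases ha : a = 0
    · obtain ⟨e, he⟩ := exists_norm_eq E zero_le_one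
      exact ⟨e, he, ha ▸ SameRay.zero_left e⟩
    · exact ⟨‖a‖⁻¹ • a, norm_smul_inv_norm ha,
        SameRay.sameRay_nonneg_smul_right a (inv_nonneg.2 (norm_nonneg a))⟩
  rcases le_total 0 s with hs | hs
  · exact ⟨e, he, hae.nonneg_smul_right hs⟩
  · refine ⟨-e, (norm_neg e).trans he, ?_⟩
    rw [smul_neg, ← neg_smul]
    exact hae.nonneg_smul_right (neg_nonneg.2 hs)

lemma exists_closedBall_le_norm_add_smul {E : Type*} [NormedAddCommGroup E] [NormedSpace ℝ E]
    [Nontrivial E] (a c : E) (s : ℝ) {r : ℝ} (hr : 0 ≤ r) :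
    ∃ c', Metric.closedBall c' (r / 4) ⊆ Metric.closedBall c r ∧
      ∀ x ∈ Metric.closedBall c' (r / 4), ‖a‖ + |s| * (r / 2) ≤ ‖a + s • (x - c)‖ := by
  obtain ⟨e, he, hae⟩ := exists_norm_eq_one_sameRay_smul a s
  have hr' : 0 ≤ 3 / 4 * r := by positivity
  refine ⟨c + (3 / 4 * r) • e, ?_, fun x hx => ?_⟩
  · refine Metric.closedBall_subset_closedBall' ?_
    rw [dist_self_add_left, norm_smul, he, Real.norm_of_nonneg hr']
    linarith
  · set y := c + (3 / 4 * r) • e with hy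
    have hcenter : ‖a + s • (y - c)‖ = ‖a‖ + |s| * (3 / 4 * r) := by
      rw [hy, add_sub_cancel_left, smul_comm, (hae.nonneg_smul_right hr').norm_add, norm_smul,
        norm_smul, he, Real.norm_of_nonneg hr', Real.norm_eq_abs, mul_one, mul_comm]
    have hdist : ‖s • (y - x)‖ ≤ |s| * (r / 4) := by
      rw [norm_smul, Real.norm_eq_abs, ← dist_eq_norm, dist_comm]
      gcongr
      exact hx
    have htri := norm_add_le (a + s • (x - c)) (s • (y - x))
    rw [show a + s • (x - c) + s • (y - x) = a + s • (y - c) by module, hcenter] at htri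
    linarith

namespace Cell

variable {d : ℕ} {K : Matrix (Fin d) (Fin d) ℝ} {T : Cell d}

lemma isPosSemidef_fluxForm (T : Cell d) (hK : K.PosDef) : (T.fluxForm K).IsPosSemidef where
  eq _ _ := integral_congr_ae (.of_forall fun _ =>
    (isPosSemidef_inner_toEuclideanLin hK.inv).eq _ _)
  nonneg _ := integral_nonneg fun _ => (isPosSemidef_inner_toEuclideanLin hK.inv).nonneg _

lemma mul_sq_mul_volume_le_fluxForm (hK : K.PosDef) {μ : ℝ} (hμ : 0 ≤ μ)
    (hle : ∀ x, μ * ‖x‖ ^ 2 ≤ inner ℝ (Matrix.toEuclideanLin K⁻¹ x) x) {s : Set (Vec d)}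
    (hs : MeasurableSet s) (hsT : s ⊆ T.set) {v : RT0 d} {t : ℝ} (ht : 0 ≤ t)
    (hv : ∀ x ∈ s, t ≤ ‖(v : Vec d → Vec d) x‖) :
    μ * t ^ 2 * volume.real s ≤ T.fluxForm K v v := by
  have hint := integrableOn_weighted_of_RT0 K v v T
  calc μ * t ^ 2 * volume.real s
      ≤ ∫ x in s, weighted K (v : Vec d → Vec d) (v : Vec d → Vec d) x := by
        refine setIntegral_ge_of_const_le_real hs
          (measure_mono hsT |>.trans_lt T.isCompact_set.measure_lt_top).ne (fun x hx => ?_)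
          (hint.mono_set hsT)
        refine le_trans ?_ (hle _)
        gcongr
        exact hv x hx
    _ ≤ T.fluxForm K v v := setIntegral_mono_set hint
        (.of_forall fun _ => (isPosSemidef_inner_toEuclideanLin hK.inv).nonneg _)
        hsT.eventuallyLE

lemma fluxForm_self_le {μ : ℝ} (hμ : 0 ≤ μ)
    (hle : ∀ x, inner ℝ (Matrix.toEuclideanLin K⁻¹ x) x ≤ μ * ‖x‖ ^ 2) {v : RT0 d} {b : ℝ}
    (hv : ∀ x ∈ T.set, ‖(v : Vec d → Vec d) x‖ ≤ b) :
    T.fluxForm K v v ≤ μ * b ^ 2 * volume.real T.set := by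
  calc T.fluxForm K v v ≤ ∫ _ in T.set, μ * b ^ 2 := by
        refine setIntegral_mono_on (integrableOn_weighted_of_RT0 K v v T)
          (integrableOn_const T.isCompact_set.measure_lt_top.ne)
          T.isCompact_set.measurableSet fun x hx => (hle _).trans ?_
        gcongr
        exact hv x hx
    _ = μ * b ^ 2 * volume.real T.set := by rw [setIntegral_const, smul_eq_mul, mul_comm]

end Cell

lemma addHaar_real_le_pow_mul_closedBall {E : Type*} [NormedAddCommGroup E] [NormedSpace ℝ E]
    [MeasurableSpace E] [BorelSpace E] [FiniteDimensional ℝ E] (μ : Measure E)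
    [μ.IsAddHaarMeasure] {s : Set E} (hs : Bornology.IsBounded s) (c : E) {r t : ℝ} (hr : 0 ≤ r)
    (ht : 0 ≤ t) (hdiam : Metric.diam s ≤ t * r) :
    μ.real s ≤ t ^ finrank ℝ E * μ.real (Metric.closedBall c r) := by
  rcases s.eq_empty_or_nonempty with rfl | ⟨x, hx⟩
  · rw [measureReal_empty]
    positivity
  calc μ.real s ≤ μ.real (Metric.closedBall x (t * r)) :=
        measureReal_mono (fun y hy => (Metric.dist_le_diam_of_mem hs hy hx).trans hdiam)
          measure_closedBall_lt_top.ne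
    _ = t ^ finrank ℝ E * μ.real (Metric.closedBall c r) := by
        rw [Measure.addHaar_real_closedBall μ x (mul_nonneg ht hr),
          Measure.addHaar_real_closedBall μ c hr, mul_pow, mul_assoc]

/-- The ball condition `diam T ≤ σ r` of shape regularity for a single simplex `T`, where `r` is
the radius of some ball inside `T`. -/
def Cell.IsShapeRegular {d : ℕ} (T : Cell d) (σ : ℝ) : Prop :=
  ∃ (c : Vec d) (r : ℝ), 0 < r ∧ Metric.closedBall c r ⊆ T.set ∧ Metric.diam T.set ≤ σ * r

lemma Cell.IsShapeRegular.nonneg {d : ℕ} {T : Cell d} {σ : ℝ} (hT : T.IsShapeRegular σ) :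
    0 ≤ σ := by
  obtain ⟨c, r, hr, -, hdiam⟩ := hT
  exact nonneg_of_mul_nonneg_left (Metric.diam_nonneg.trans hdiam) hr

/-- The quotient of the largest and the smallest eigenvalue of the symmetric matrix `K` is at
most `κ`; the witness is a positive lower bound of the spectrum. -/
def IsAnisotropyLE {d : ℕ} (K : Matrix (Fin d) (Fin d) ℝ) (κ : ℝ) : Prop :=
  ∃ m : ℝ, 0 < m ∧ ∀ ξ : Vec d, m * ‖ξ‖ ^ 2 ≤ inner ℝ (Matrix.toEuclideanLin K ξ) ξ ∧
    inner ℝ (Matrix.toEuclideanLin K ξ) ξ ≤ κ * m * ‖ξ‖ ^ 2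

lemma IsAnisotropyLE.one_le {d : ℕ} {K : Matrix (Fin (d + 1)) (Fin (d + 1)) ℝ} {κ : ℝ}
    (hK : IsAnisotropyLE K κ) : 1 ≤ κ := by
  obtain ⟨m, hm, hbounds⟩ := hK
  obtain ⟨ξ, hξ⟩ := exists_norm_eq (Vec (d + 1)) zero_le_one
  have hξ_bounds := (hbounds ξ).1.trans (hbounds ξ).2
  rw [hξ, one_pow, mul_one, mul_one] at hξ_bounds
  exact le_of_mul_le_mul_right (by rwa [one_mul]) hm

/-- The constant in the bound of the diagonal element form by the element form on a
`d`-dimensional simplex: `d + 1` facets, the inverse inequality for the normal components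
(the factors `(1 + 2σ)²` and `(4σ)^d`), the size `σ` of the basis fields, and the anisotropy. -/
noncomputable def diagConst (d : ℕ) (σ κ : ℝ) : ℝ :=
  (d + 1) * ((1 + 2 * σ) ^ 2 * σ ^ 2 * (4 * σ) ^ d * κ)

namespace Cell

variable {d : ℕ} {K : Matrix (Fin (d + 1)) (Fin (d + 1)) ℝ} {T : Cell (d + 1)}

/-- The field is large on a ball of radius `r / 4` inside the inscribed ball, and the volume of
that ball is comparable to the volume of the simplex. -/
lemma sq_normalComp_mul_volume_le (hK : K.PosDef) {M : ℝ} (hM : 0 < M)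
    (hle : ∀ x, inner ℝ (Matrix.toEuclideanLin K x) x ≤ M * ‖x‖ ^ 2) {c : Vec (d + 1)} {r σ : ℝ}
    (hr : 0 < r) (hσ : 0 ≤ σ) (hball : Metric.closedBall c r ⊆ T.set)
    (hdiam : Metric.diam T.set ≤ σ * r) (v : RT0 (d + 1)) (f : Fin (d + 2)) :
    T.normalComp f v ^ 2 * volume.real T.set ≤
      (1 + 2 * σ) ^ 2 * (4 * σ) ^ (d + 1) * M * T.fluxForm K v v := by
  obtain ⟨s, hs⟩ := RT0.exists_eq_add_smul_sub v c
  obtain ⟨c', hc'r, hc'⟩ := exists_closedBall_le_norm_add_smul ((v : Vec (d + 1) → _) c) c s hr.le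
  set t := ‖(v : Vec (d + 1) → Vec (d + 1)) c‖ + |s| * (r / 2)
  set b := volume.real (Metric.closedBall c' (r / 4))
  have hcomp : |T.normalComp f v| ≤ (1 + 2 * σ) * t := by
    have hnorm := T.abs_normalComp_le (hball (Metric.mem_closedBall_self hr.le)) hs f
    have hs_diam : |s| * Metric.diam T.set ≤ |s| * (σ * r) := by gcongr
    have hmean : 0 ≤ σ * ‖(v : Vec (d + 1) → Vec (d + 1)) c‖ := by positivity
    have hslope : 0 ≤ |s| * r := by positivity
    linear_combination hnorm + hs_diam + 2 * hmean + hslope / 2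
  have hvol : volume.real T.set ≤ (4 * σ) ^ (d + 1) * b := by
    simpa using addHaar_real_le_pow_mul_closedBall volume T.isCompact_set.isBounded c'
      (r := r / 4) (t := 4 * σ) (by positivity) (by positivity) (by linarith)
  have hflux : M⁻¹ * t ^ 2 * b ≤ T.fluxForm K v v :=
    mul_sq_mul_volume_le_fluxForm hK (inv_nonneg.2 hM.le) (le_inner_toEuclideanLin_inv hK hM hle)
      measurableSet_closedBall (hc'r.trans hball) (by positivity)
      fun x hx => (hc' x hx).trans_eq (by rw [hs x])
  calc T.normalComp f v ^ 2 * volume.real T.set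
      ≤ ((1 + 2 * σ) * t) ^ 2 * ((4 * σ) ^ (d + 1) * b) := by
        rw [← sq_abs]
        gcongr
    _ = (1 + 2 * σ) ^ 2 * (4 * σ) ^ (d + 1) * M * (M⁻¹ * t ^ 2 * b) := by field_simp
    _ ≤ (1 + 2 * σ) ^ 2 * (4 * σ) ^ (d + 1) * M * T.fluxForm K v v := by gcongr

lemma diagFluxForm_apply (T : Cell (d + 1)) (u v : RT0 (d + 1)) :
    T.diagFluxForm K u v = ∑ f, T.normalComp f u * T.normalComp f v *
      T.fluxForm K (T.basisField f) (T.basisField f) := rfl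

lemma isPosSemidef_diagFluxForm (T : Cell (d + 1)) (hK : K.PosDef) :
    (T.diagFluxForm K).IsPosSemidef where
  eq u v := by simp only [diagFluxForm_apply, mul_comm (T.normalComp _ u), RingHom.id_apply]
  nonneg v := by
    rw [diagFluxForm_apply]
    exact Finset.sum_nonneg fun _ _ =>
      mul_nonneg (mul_self_nonneg _) ((T.isPosSemidef_fluxForm hK).nonneg _)

lemma fluxForm_self_le_diagFluxForm (T : Cell (d + 1)) (hK : K.PosDef) (v : RT0 (d + 1)) :
    T.fluxForm K v v ≤ (d + 2) * T.diagFluxForm K v v := by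
  have hcard := apply_sum_self_le_card_mul (T.isPosSemidef_fluxForm hK)
    fun f => T.normalComp f v • T.basisField f
  rw [T.sum_normalComp_smul_basisField] at hcard
  simp only [map_smul, LinearMap.smul_apply, smul_eq_mul, Fintype.card_fin, ← mul_assoc] at hcard
  exact_mod_cast hcard

lemma diagFluxForm_self_le_fluxForm (hK : K.PosDef) {σ κ : ℝ} (hT : T.IsShapeRegular σ)
    (hκ : IsAnisotropyLE K κ) (v : RT0 (d + 1)) :
    T.diagFluxForm K v v ≤ diagConst (d + 1) σ κ * T.fluxForm K v v := by
  have hσ := hT.nonneg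
  have hκ_pos : 0 < κ := zero_lt_one.trans_le hκ.one_le
  obtain ⟨c, r, hr, hball, hdiam⟩ := hT
  obtain ⟨m, hm, hbounds⟩ := hκ
  have hbasis (f : Fin (d + 2)) :
      T.fluxForm K (T.basisField f) (T.basisField f) ≤ m⁻¹ * σ ^ 2 * volume.real T.set :=
    fluxForm_self_le (inv_nonneg.2 hm.le)
      (inner_toEuclideanLin_inv_le hK hm fun x => (hbounds x).1)
      fun x hx => T.norm_basisField_le hr.le hσ hball hdiam f hx
  have hcomp (f : Fin (d + 2)) := sq_normalComp_mul_volume_le hK (mul_pos hκ_pos hm)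
    (fun x => (hbounds x).2) hr hσ hball hdiam v f
  rw [diagFluxForm_apply]
  calc ∑ f, T.normalComp f v * T.normalComp f v * T.fluxForm K (T.basisField f) (T.basisField f)
      ≤ ∑ f, m⁻¹ * σ ^ 2 * (T.normalComp f v ^ 2 * volume.real T.set) :=
        Finset.sum_le_sum fun f _ =>
          (mul_le_mul_of_nonneg_left (hbasis f) (mul_self_nonneg _)).trans_eq (by ring)
    _ ≤ ∑ _f : Fin (d + 2), m⁻¹ * σ ^ 2 *
          ((1 + 2 * σ) ^ 2 * (4 * σ) ^ (d + 1) * (κ * m) * T.fluxForm K v v) := by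
        exact Finset.sum_le_sum fun f _ => mul_le_mul_of_nonneg_left (hcomp f) (by positivity)
    _ = diagConst (d + 1) σ κ * T.fluxForm K v v := by
        rw [Finset.sum_const, Finset.card_univ, Fintype.card_fin, nsmul_eq_mul, diagConst]
        push_cast
        field_simp
        ring

end Cell

lemma diagConst_le_diagConst {d n : ℕ} (hdn : d ≤ n) {σ σ' κ κ' : ℝ} (hσ : 0 ≤ σ)
    (hσ' : σ ≤ σ') (hone : 1 ≤ σ') (hκ : 0 ≤ κ) (hκ' : κ ≤ κ') :
    diagConst d σ κ ≤ diagConst n σ' κ' := by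
  have hpow : (4 * σ) ^ d ≤ (4 * σ') ^ n :=
    (pow_le_pow_left₀ (by positivity) (by gcongr) d).trans
      (pow_le_pow_right₀ (by linarith) hdn)
  unfold diagConst
  gcongr

lemma one_le_diagConst (n : ℕ) {σ κ : ℝ} (hσ : 1 ≤ σ) (hκ : 1 ≤ κ) : 1 ≤ diagConst n σ κ := by
  have hfactors := one_le_mul_of_one_le_of_one_le (one_le_mul_of_one_le_of_one_le
    (one_le_mul_of_one_le_of_one_le (one_le_pow₀ (by linarith : 1 ≤ 1 + 2 * σ) (n := 2))
      (one_le_pow₀ hσ (n := 2))) (one_le_pow₀ (by linarith : 1 ≤ 4 * σ) (n := n))) hκ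
  exact one_le_mul_of_one_le_of_one_le (by simp) hfactors

/-! ### The global operators -/

lemma Geometry.isEmpty_I {n : ℕ} (G : Geometry n) {d : ℕ} (hd : n < d) : IsEmpty (G.I d) := by
  refine ⟨fun i => ?_⟩
  have hrank := LinearMap.finrank_le_finrank_of_injective
    (f := (G.emb d i).linearIsometry.toLinearMap) (G.emb d i).linearIsometry.injective
  simp only [finrank_euclideanSpace, Fintype.card_fin] at hrank
  omega

lemma finiteDimensional_pi_nat {F : ℕ → Type*} [∀ d, AddCommGroup (F d)] [∀ d, Module ℝ (F d)]
    [∀ d, FiniteDimensional ℝ (F d)] (N : ℕ) (hF : ∀ d, N < d → Subsingleton (F d)) :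
    FiniteDimensional ℝ (∀ d, F d) := by
  let restrict : (∀ d, F d) →ₗ[ℝ] ∀ d : Fin (N + 1), F d :=
    LinearMap.pi fun d => LinearMap.proj (d : ℕ)
  refine FiniteDimensional.of_injective restrict fun u v huv => funext fun d => ?_
  rcases lt_or_ge N d with hd | hd
  · exact (hF d hd).elim _ _
  · exact congrFun huv ⟨d, by omega⟩

section Global

variable {n : ℕ} {G : Geometry n} (𝒯 : Discretization G)

instance : FiniteDimensional ℝ (Broken 𝒯) :=
  finiteDimensional_pi_nat n fun d hd => by
    have := G.isEmpty_I (Nat.lt_succ_of_lt hd)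
    infer_instance

instance : FiniteDimensional ℝ (Lambdah 𝒯) :=
  finiteDimensional_pi_nat n fun d hd => by
    have := G.isEmpty_I hd
    infer_instance

instance : FiniteDimensional ℝ (Qh 𝒯) :=
  finiteDimensional_pi_nat n fun d hd => by
    have := G.isEmpty_I hd
    infer_instance

instance : AddCommGroup (Wh 𝒯) := inferInstanceAs (AddCommGroup (↥(V0h 𝒯) × Lambdah 𝒯))

variable (P : Params G)

lemma mortarForm_apply (l μ : Lambdah 𝒯) : mortarForm 𝒯 P l μ =
    ∑ d ∈ Finset.range n, ∑ i : G.I d, ∑ j : G.J d i, ∑ M : ↥(𝒯.mortar d i j).cells,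
      P.γ d i j * (P.Kν d i j)⁻¹ * volume.real M.1.set * l d i j M * μ d i j M := rfl

lemma bulkForm_apply (u v : Broken 𝒯) : bulkForm 𝒯 P u v =
    ∑ d ∈ Finset.range n, ∑ k : G.I (d + 1), ∑ T : ↥(𝒯.mesh (d + 1) k).cells,
      T.1.fluxForm (P.K d k) (u d k T) (v d k T) := rfl

lemma diagBulkForm_apply (u v : Broken 𝒯) : diagBulkForm 𝒯 P u v =
    ∑ d ∈ Finset.range n, ∑ k : G.I (d + 1), ∑ T : ↥(𝒯.mesh (d + 1) k).cells,
      T.1.diagFluxForm (P.K d k) (u d k T) (v d k T) := rfl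

lemma isPosSemidef_mortarForm : (mortarForm 𝒯 P).IsPosSemidef where
  eq l μ := by simp only [mortarForm_apply, mul_right_comm, RingHom.id_apply]
  nonneg μ := by
    rw [mortarForm_apply]
    refine Finset.sum_nonneg fun d _ => Finset.sum_nonneg fun i _ => Finset.sum_nonneg fun j _ =>
      Finset.sum_nonneg fun M _ => ?_
    have hγ := P.γ_pos d i j
    have hKν := P.Kν_pos d i j
    rw [mul_assoc]
    exact mul_nonneg (by positivity) (mul_self_nonneg _)

lemma isPosSemidef_bulkForm : (bulkForm 𝒯 P).IsPosSemidef where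
  eq u v := by
    rw [bulkForm_apply, bulkForm_apply, RingHom.id_apply]
    exact Finset.sum_congr rfl fun d _ => Finset.sum_congr rfl fun k _ =>
      Finset.sum_congr rfl fun T _ => (T.1.isPosSemidef_fluxForm (P.K_posDef d k)).eq _ _
  nonneg v := by
    rw [bulkForm_apply]
    exact Finset.sum_nonneg fun d _ => Finset.sum_nonneg fun k _ =>
      Finset.sum_nonneg fun T _ => (T.1.isPosSemidef_fluxForm (P.K_posDef d k)).nonneg _

lemma isPosSemidef_diagBulkForm : (diagBulkForm 𝒯 P).IsPosSemidef where
  eq u v := by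
    rw [diagBulkForm_apply, diagBulkForm_apply, RingHom.id_apply]
    exact Finset.sum_congr rfl fun d _ => Finset.sum_congr rfl fun k _ =>
      Finset.sum_congr rfl fun T _ => (T.1.isPosSemidef_diagFluxForm (P.K_posDef d k)).eq _ _
  nonneg v := by
    rw [diagBulkForm_apply]
    exact Finset.sum_nonneg fun d _ => Finset.sum_nonneg fun k _ =>
      Finset.sum_nonneg fun T _ => (T.1.isPosSemidef_diagFluxForm (P.K_posDef d k)).nonneg _

lemma isPosSemidef_opA : (opA 𝒯 P).IsPosSemidef :=
  (isPosSemidef_compl₁₂ (isPosSemidef_bulkForm 𝒯 P) _).add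
    (isPosSemidef_compl₁₂ (isPosSemidef_mortarForm 𝒯 P) _)

lemma isPosSemidef_opDA : (opDA 𝒯 P).IsPosSemidef :=
  (isPosSemidef_compl₁₂ (isPosSemidef_diagBulkForm 𝒯 P) _).add
    (isPosSemidef_compl₁₂ (isPosSemidef_mortarForm 𝒯 P) _)

lemma bulkForm_self_le_diagBulkForm (v : Broken 𝒯) :
    bulkForm 𝒯 P v v ≤ (n + 1) * diagBulkForm 𝒯 P v v := by
  simp only [bulkForm_apply, diagBulkForm_apply, Finset.mul_sum]
  refine Finset.sum_le_sum fun d hd => Finset.sum_le_sum fun k _ =>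
    Finset.sum_le_sum fun T _ => ?_
  have hdn : (d + 1 : ℝ) ≤ n := by exact_mod_cast Finset.mem_range.1 hd
  exact (T.1.fluxForm_self_le_diagFluxForm (P.K_posDef d k) _).trans <|
    mul_le_mul_of_nonneg_right (by linarith)
      ((T.1.isPosSemidef_diagFluxForm (P.K_posDef d k)).nonneg _)

lemma opA_self_le_opDA (w : Wh 𝒯) : opA 𝒯 P w w ≤ (n + 1) * opDA 𝒯 P w w := by
  calc opA 𝒯 P w w
      ≤ (n + 1) * diagBulkForm 𝒯 P (totalFlux 𝒯 w) (totalFlux 𝒯 w) +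
          (n + 1) * mortarForm 𝒯 P w.2 w.2 :=
        add_le_add (bulkForm_self_le_diagBulkForm 𝒯 P _)
          (le_mul_of_one_le_left ((isPosSemidef_mortarForm 𝒯 P).nonneg _) (by simp))
    _ = (n + 1) * opDA 𝒯 P w w := (mul_add ..).symm

variable {𝒯 P} {σ κ : ℝ}

lemma diagBulkForm_self_le_bulkForm (hP : P.AnisotropyLE κ) (hT : 𝒯.ShapeRegular σ)
    (v : Broken 𝒯) :
    diagBulkForm 𝒯 P v v ≤ diagConst n (max σ 1) (max κ 1) * bulkForm 𝒯 P v v := by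
  simp only [bulkForm_apply, diagBulkForm_apply, Finset.mul_sum]
  refine Finset.sum_le_sum fun d hd => Finset.sum_le_sum fun k _ =>
    Finset.sum_le_sum fun T _ => ?_
  have hTσ : T.1.IsShapeRegular σ := hT d k T.1 T.2
  have hKκ : IsAnisotropyLE (P.K d k) κ := hP d k
  refine (T.1.diagFluxForm_self_le_fluxForm (P.K_posDef d k) hTσ hKκ _).trans ?_
  refine mul_le_mul_of_nonneg_right ?_ ((T.1.isPosSemidef_fluxForm (P.K_posDef d k)).nonneg _)
  exact diagConst_le_diagConst (Finset.mem_range.1 hd) hTσ.nonneg (le_max_left _ _)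
    (le_max_right _ _) (zero_le_one.trans hKκ.one_le) (le_max_left _ _)

lemma opDA_self_le_opA (hP : P.AnisotropyLE κ) (hT : 𝒯.ShapeRegular σ) (w : Wh 𝒯) :
    opDA 𝒯 P w w ≤ diagConst n (max σ 1) (max κ 1) * opA 𝒯 P w w := by
  calc opDA 𝒯 P w w
      ≤ diagConst n (max σ 1) (max κ 1) * bulkForm 𝒯 P (totalFlux 𝒯 w) (totalFlux 𝒯 w) +
          diagConst n (max σ 1) (max κ 1) * mortarForm 𝒯 P w.2 w.2 :=
        add_le_add (diagBulkForm_self_le_bulkForm hP hT _)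
          (le_mul_of_one_le_left ((isPosSemidef_mortarForm 𝒯 P).nonneg _)
            (one_le_diagConst n (le_max_right _ _) (le_max_right _ _)))
    _ = diagConst n (max σ 1) (max κ 1) * opA 𝒯 P w w := (mul_add ..).symm

lemma spectrallyEquiv_schur_opA {c₁w c₂w c₁p c₂p : ℝ} {Hw : Dual ℝ (Wh 𝒯) →ₗ[ℝ] Wh 𝒯}
    {Hp : Dual ℝ (Qh 𝒯) →ₗ[ℝ] Qh 𝒯} (hP : P.AnisotropyLE κ) (hT : 𝒯.ShapeRegular σ)
    (hHw : IsSPD Hw) (hHp : IsSPD Hp) (hc₁w : 0 < c₁w) (hc₁p : 0 < c₁p)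
    (hw : SpectrallyEquiv c₁w c₂w Hw (opA 𝒯 P)) (hp : SpectrallyEquiv c₁p c₂p Hp (opS 𝒯 P)) :
    SpectrallyEquiv ((diagConst n (max σ 1) (max κ 1))⁻¹ * c₁p) ((n + 1) * c₂p) Hp
      (schur (opA 𝒯 P) (opB 𝒯)) := by
  have hn : (0 : ℝ) < n + 1 := by positivity
  have hDbij : Function.Bijective (opDA 𝒯 P) := bijective_of_pos fun w hw_ne =>
    pos_of_mul_pos_right ((hw.pos hc₁w hHw hw_ne).trans_le (opA_self_le_opDA 𝒯 P w)) hn.le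
  exact SpectrallyEquiv.schur_of_le (D := opDA 𝒯 P) hp hc₁p hn
    (zero_lt_one.trans_le (one_le_diagConst n (le_max_right _ _) (le_max_right _ _))) hHp
    (isPosSemidef_opA 𝒯 P) (hw.bijective hc₁w hHw) (isPosSemidef_opDA 𝒯 P) hDbij
    (opA_self_le_opDA 𝒯 P) (opDA_self_le_opA hP hT)

end Global

end FracturedFlow

open FracturedFlow in
theorem mainTheorem9_general (n : ℕ) (σ κ c₁w c₂w c₁p c₂p : ℝ) (hc₁w : 1 / 4 < c₁w)
    (hc₂w : 0 < c₂w) (hc₁p : 0 < c₁p) (hc₂p : 0 < c₂p) :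
    ∃ ξ₁ > (0 : ℝ), ∃ ξ₂ > (0 : ℝ),
      ∀ (G : Geometry n) (P : Params G) (𝒯 : Discretization G),
        P.AnisotropyLE κ → 𝒯.ShapeRegular σ →
      ∀ (Hw : Dual ℝ (Wh 𝒯) →ₗ[ℝ] Wh 𝒯) (Hp : Dual ℝ (Qh 𝒯) →ₗ[ℝ] Qh 𝒯),
        IsSPD Hw → IsSPD Hp →
        SpectrallyEquiv c₁w c₂w Hw (opA 𝒯 P) →
        SpectrallyEquiv c₁p c₂p Hp (opS 𝒯 P) →
        Function.Bijective (upperBlock 𝒯 Hw Hp) ∧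
        ∀ (x : Wh 𝒯 × Qh 𝒯) (x' : Dual ℝ (Wh 𝒯) × Dual ℝ (Qh 𝒯)),
          x ≠ 0 → x' = upperBlock 𝒯 Hw Hp x →
          ξ₁ ≤ dualInner (precondD 𝒯 Hw Hp) (saddle 𝒯 P (precondU 𝒯 Hw Hp x')) x' /
              dualInner (precondD 𝒯 Hw Hp) x' x' ∧
          dualNorm (precondD 𝒯 Hw Hp) (saddle 𝒯 P (precondU 𝒯 Hw Hp x')) /
              dualNorm (precondD 𝒯 Hw Hp) x' ≤ ξ₂ := by
  have hc₁w_pos : 0 < c₁w := by linarith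
  have hβ : 0 < diagConst n (max σ 1) (max κ 1) :=
    zero_lt_one.trans_le (one_le_diagConst n (le_max_right _ _) (le_max_right _ _))
  have hc₁s : 0 < (diagConst n (max σ 1) (max κ 1))⁻¹ * c₁p := by positivity
  have hc₂s : 0 < (n + 1) * c₂p := by positivity
  refine ⟨_, lowerBound_pos hc₁w hc₂w hc₂s, _, upperBound_pos hc₁w_pos hc₁s, ?_⟩
  intro G P 𝒯 hP hT Hw Hp hHw hHp hw hp
  have hs := spectrallyEquiv_schur_opA hP hT hHw hHp hc₁w_pos hc₁p hw hp
  have hbij : Function.Bijective (upperBlock 𝒯 Hw Hp) :=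
    triangularOp_bijective hHw.bijective hHp.bijective
  refine ⟨hbij, fun x x' hx hx' => ?_⟩
  have hMx' : precondU 𝒯 Hw Hp x' = x := by rw [hx', precondU, opInv_apply_self hbij]
  rw [hMx', hx']
  exact fieldOfValues_bounds (isPosSemidef_opA 𝒯 P) hHw hHp hc₁w hc₂w hc₁s hc₂s hw hs hx

open FracturedFlow Module in
theorem mainTheorem9 (n : ℕ) (hn : n = 2 ∨ n = 3)
    (σ κ c₁w c₂w c₁p c₂p ρ : ℝ)
    (hc₁w : 0 < c₁w) (hc₂w : 0 < c₂w) (hc₁p : 0 < c₁p) (hc₂p : 0 < c₂p)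
    (hρ₀ : 0 ≤ ρ) (hρ₁ : ρ < 1) :
    ∃ ξ₁ > (0 : ℝ), ∃ ξ₂ > (0 : ℝ),
      ∀ (G : Geometry n) (P : Params G) (𝒯 : Discretization G),
        P.AnisotropyLE κ → 𝒯.ShapeRegular σ →
      ∀ (Hw : Dual ℝ (Wh 𝒯) →ₗ[ℝ] Wh 𝒯) (Hp : Dual ℝ (Qh 𝒯) →ₗ[ℝ] Qh 𝒯),
        IsSPD Hw → IsSPD Hp →
        SpectrallyEquiv c₁w c₂w Hw (opA 𝒯 P) →
        SpectrallyEquiv c₁p c₂p Hp (opS 𝒯 P) →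
        (∀ w : Wh 𝒯, opNorm (opA 𝒯 P) (w - Hw (opA 𝒯 P w)) ≤ ρ * opNorm (opA 𝒯 P) w) →
        Function.Bijective (upperBlock 𝒯 Hw Hp) ∧
        ∀ (x : Wh 𝒯 × Qh 𝒯) (x' : Dual ℝ (Wh 𝒯) × Dual ℝ (Qh 𝒯)),
          x ≠ 0 → x' = upperBlock 𝒯 Hw Hp x →
          ξ₁ ≤ dualInner (precondD 𝒯 Hw Hp) (saddle 𝒯 P (precondU 𝒯 Hw Hp x')) x' /
              dualInner (precondD 𝒯 Hw Hp) x' x' ∧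
          dualNorm (precondD 𝒯 Hw Hp) (saddle 𝒯 P (precondU 𝒯 Hw Hp x')) /
              dualNorm (precondD 𝒯 Hw Hp) x' ≤ ξ₂ := by
  obtain ⟨ξ₁, hξ₁, ξ₂, hξ₂, hbounds⟩ := mainTheorem9_general n σ κ (1 + ρ)⁻¹ c₂w c₁p c₂p
    (by rw [one_div, inv_lt_inv₀] <;> linarith) hc₂w hc₁p hc₂p
  exact ⟨ξ₁, hξ₁, ξ₂, hξ₂, fun G P 𝒯 hP hT Hw Hp hHw hHp hw hp hcontr =>
    hbounds G P 𝒯 hP hT Hw Hp hHw hHp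
      (hw.of_contraction hc₁w hHw (isPosSemidef_opA 𝒯 P) (by linarith) hcontr) hp⟩
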